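/- **Theorem (Generalized quantum double model).** Let $H$ be a finite-dimensional Hopf $C^*$-algebra, i.e. a finite-dimensional complex Hopf algebra $(H,\Delta,\varepsilon,S)$ which is a $C^*$-algebra with $\Delta(x^*)=\Delta(x)^*$, where $(x\otimes y)^*=x^*\otimes y^*$. Let $h\in H$ be its Haar integral ($xh=hx=\varepsilon(x)h$ for all $x \in H$, $\varepsilon(h)=1$) and $\phi\in H^*$ its Haar functional ($\sum x'\phi(x'')=\sum\phi(x')x''=\phi(x)1$ for all $x \in H$, $\phi(1)=1$). Let $X=(H^{\mathrm{op}})^*$, with coproduct $\sum f'(x)f''(y)=f(yx)$ and counit $f\mapsto f(1)$. For $a,x\in H$ and $f\in X$ put $$L_+^a(x)=ax,\quad L_-^a(x)=x\,S(a),\quad T_+^f(x)=\sum f(x'')\,x',\quad T_-^f(x)=\sum f(S^{-1}(x'))\,x''.$$ Let $\Gamma=(V,E,F)$ be a finite oriented graph embedded in an oriented surface (with its cyclic order of edge ends around each vertex and of edges around each face; loops, multiple edges, isolated vertices, boundaries and holes are allowed). Let $\mathcal N_\Gamma=\bigotimes_{e\in E}H$ with the tensor product of the forms $(a,b)_H=\phi(a^*b)$.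 A site $(s,p)$ is a vertex $s$ with an adjacent face $p$ (more precisely, a corner of $p$ at $s$). For $a\in H$ the vertex operator $A_a(s,p)=\sum L^{a^{(1)}}\cdots L^{a^{(r)}}$ distributes the coproduct of $a$ over the edge ends at $s$ in counterclockwise order starting from $p$, using $L_+$ on ends of edges pointing towards $s$ and $L_-$ on ends of edges pointing away from $s$. For $f\in X$ the face operator $B_f(s,p)=\sum T^{f^{(1)}}\cdots T^{f^{(r)}}$ distributes the coproduct of $f$ over the edges around $p$ in clockwise order starting from $s$, using $T_-$ if $p$ lies to the left of the edge and $T_+$ if it lies to the right. (An empty product is read as the counit times the identity.) Then: 1. The form on $\mathcal N_\Gamma$ is a Hermitian inner product. The operator $A(s):=A_h(s,p)$ does not depend on the choice of the site at $s$, and $B(p):=B_\phi(s,p)$ does not depend on the choice of the site at $p$. 2. All $A(s)$, $s\in V$, and all $B(p)$, $p\in F$, are Hermitian projectors, and all of them commute with each other. 3. $\mathcal H=-\sum_{s\in V}A(s)-\sum_{p\in F}B(p)$ is a local, frustration-free Hamiltonian: $A(s)$ acts only on the tensor factors of the edges at $s$ and $B(p)$ only on those of the boundary edges of $p$; $\mathcal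 H$ has a ground state, and every ground state of $\mathcal H$ is a ground state of each of the commuting terms $-A(s)$ and $-B(p)$. -/

import Mathlib

open scoped TensorProduct ComplexConjugate

namespace QuantumDouble

noncomputable section

/-! ## Finite-dimensional Hopf C*-algebras -/

/-- A finite-dimensional Hopf `C*`-algebra: a finite-dimensional complex Hopf algebra carrying a
norm and an involution which make it a `C*`-algebra (completeness is automatic in finite
dimension), such that the comultiplication is compatible with the involution
`(x ⊗ y)* = x* ⊗ y*` of `H ⊗ H`. -/
class HopfCStarAlgebra (H : Type*) [NormedRing H] [StarRing H] [HopfAlgebra ℂ H] : Prop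
    extends CStarRing H, StarModule ℂ H, NormSMulClass ℂ H, FiniteDimensional ℂ H where
  comul_star : ∀ x : H, Coalgebra.comul (R := ℂ) (star x) = star (Coalgebra.comul (R := ℂ) x)

section Hopf

variable {H : Type*} [NormedRing H] [StarRing H] [HopfAlgebra ℂ H]

/-- `h` is the Haar integral of `H`: the two-sided integral `x h = h x = ε(x) h`, normalised
by `ε(h) = 1`. -/
def IsHaarIntegral (h : H) : Prop :=
  (∀ x : H, x * h = Coalgebra.counit (R := ℂ) x • h ∧ h * x = Coalgebra.counit (R := ℂ) x • h) ∧
    Coalgebra.counit (R := ℂ) h = 1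

/-- `φ` is the Haar functional of `H`, that is, the Haar integral of the dual Hopf algebra:
`∑ x' φ(x'') = ∑ φ(x') x'' = φ(x) 1`, normalised by `φ(1) = 1`. -/
def IsHaarFunctional (φ : Module.Dual ℂ H) : Prop :=
  (∀ x : H, TensorProduct.rid ℂ H (φ.lTensor H (Coalgebra.comul (R := ℂ) x)) = φ x • (1 : H) ∧
    TensorProduct.lid ℂ H (φ.rTensor H (Coalgebra.comul (R := ℂ) x)) = φ x • (1 : H)) ∧
    φ 1 = 1

variable (H) in
/-- The inverse `S⁻¹(x) = S(x*)*` of the antipode of a Hopf `*`-algebra; that it is the inverse is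
proved below. -/
def antipodeInv [HopfCStarAlgebra H] : H →ₗ[ℂ] H where
  toFun x := star (HopfAlgebra.antipode ℂ (star x))
  map_add' x y := by simp
  map_smul' c x := by simp

open Coalgebra in
/-- The comultiplication of `x*` in Sweedler notation. -/
def starRepr [HopfCStarAlgebra H] {ι : Type*} {x : H} (r : Repr ℂ x ι) :
    Repr ℂ (star x) ι where
  index := r.index
  left i := star (r.left i)
  right i := star (r.right i)
  eq := by rw [HopfCStarAlgebra.comul_star, ← r.eq, star_sum]; simp

open Coalgebra in
/-- The counit of a Hopf `*`-algebra is compatible with the involution. -/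
lemma counit_star [HopfCStarAlgebra H] (x : H) :
    counit (R := ℂ) (star x) = conj (counit (R := ℂ) x) := by
  have h1 : ∑ i ∈ (ℛ ℂ x).index, conj (counit (R := ℂ) (star ((ℛ ℂ x).left i))) *
      counit (R := ℂ) ((ℛ ℂ x).right i) = counit (R := ℂ) x := by
    have h := congrArg star (sum_counit_smul (starRepr (ℛ ℂ x)))
    simp only [starRepr, star_sum, star_smul, star_star] at h
    simpa using congrArg (counit (R := ℂ)) h
  have h2 : ∑ i ∈ (ℛ ℂ x).index, counit (R := ℂ) (star ((ℛ ℂ x).left i)) *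
      conj (counit (R := ℂ) ((ℛ ℂ x).right i)) = counit (R := ℂ) (star x) := by
    have h := congrArg (TensorProduct.rid ℂ H) (sum_tmul_counit_eq (ℛ ℂ x))
    simp only [map_sum, TensorProduct.rid_tmul, one_smul] at h
    have h := congrArg (fun y => counit (R := ℂ) (star y)) h
    simpa [star_sum, mul_comm] using h
  rw [← h2, ← h1]
  simp

open Coalgebra in
lemma antipode_antipodeInv [HopfCStarAlgebra H] (x : H) :
    HopfAlgebra.antipode ℂ (antipodeInv H x) = x := by
  have key : ∀ y : H, ∑ i ∈ (ℛ ℂ y).index, antipodeInv H ((ℛ ℂ y).right i) * (ℛ ℂ y).left i =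
      counit (R := ℂ) y • (1 : H) := by
    intro y
    have h := congrArg star (HopfAlgebra.sum_mul_antipode_eq_smul (starRepr (ℛ ℂ y)))
    simpa [starRepr, star_sum, counit_star, antipodeInv] using h
  have inv : WithConv.toConv (HopfAlgebra.antipode ℂ (A := H)) *
      WithConv.toConv (HopfAlgebra.antipode ℂ ∘ₗ antipodeInv H) = 1 := by
    ext y
    rw [(ℛ ℂ y).convMul_apply]
    have h := congrArg (HopfAlgebra.antipode ℂ) (key y)
    simpa [map_sum, HopfAlgebra.antipode_mul_antidistrib, Algebra.algebraMap_eq_smul_one] using h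
  have h := left_inv_eq_right_inv LinearMap.id_mul_antipode inv
  exact (congrArg (fun f : WithConv (H →ₗ[ℂ] H) => f x) h).symm

lemma antipodeInv_antipode [HopfCStarAlgebra H] (x : H) :
    antipodeInv H (HopfAlgebra.antipode ℂ x) = x := by
  have h := congrArg star (antipode_antipodeInv (star x))
  simpa [antipodeInv] using h

/-- The comultiplication of `X = (H^op)^*`, dual to the opposite multiplication of `H`:
`∑ f'(x) f''(y) = f(y x)`. -/
def comulX [HopfCStarAlgebra H] :
    Module.Dual ℂ H →ₗ[ℂ] Module.Dual ℂ H ⊗[ℂ] Module.Dual ℂ H :=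
  (TensorProduct.dualDistribEquiv ℂ H H).symm.toLinearMap ∘ₗ
    Module.Dual.transpose (R := ℂ)
      (LinearMap.mul' ℂ H ∘ₗ (TensorProduct.comm ℂ H H).toLinearMap)

/-- The counit `f ↦ f(1)` of `X = (H^op)^*`. -/
def counitX : Module.Dual ℂ H →ₗ[ℂ] ℂ := Module.Dual.eval ℂ H 1

/-! ## The four actions on a single edge -/

/-- `L₊^a(x) = a x`. -/
def Lplus : H →ₗ[ℂ] Module.End ℂ H := LinearMap.mul ℂ H

/-- `L₋^a(x) = x S(a)`. -/
def Lminus : H →ₗ[ℂ] Module.End ℂ H := (LinearMap.mul ℂ H).flip ∘ₗ HopfAlgebra.antipode ℂ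

/-- `T₊^f(x) = ∑ f(x'') x'`. -/
def Tplus : Module.Dual ℂ H →ₗ[ℂ] Module.End ℂ H where
  toFun f := (TensorProduct.rid ℂ H).toLinearMap ∘ₗ f.lTensor H ∘ₗ Coalgebra.comul
  map_add' f g := by ext; simp [LinearMap.lTensor_add]
  map_smul' c f := by ext; simp [LinearMap.lTensor_smul]

/-- `T₋^f(x) = ∑ f(S⁻¹(x')) x''`. -/
def Tminus [HopfCStarAlgebra H] : Module.Dual ℂ H →ₗ[ℂ] Module.End ℂ H where
  toFun f := (TensorProduct.lid ℂ H).toLinearMap ∘ₗ (f ∘ₗ antipodeInv H).rTensor H ∘ₗ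
    Coalgebra.comul
  map_add' f g := by ext; simp [LinearMap.add_comp, LinearMap.rTensor_add]
  map_smul' c f := by ext; simp [LinearMap.smul_comp, LinearMap.rTensor_smul]

end Hopf

/-- Given a coalgebra `(C, Δ, ε)`, an algebra `A` and linear maps `α₁, …, α_r : C → A`, the map
`c ↦ ∑ α₁(c⁽¹⁾) ⋯ α_r(c⁽ʳ⁾)`; for the empty list this is `c ↦ ε(c) 1`. -/
def distribute {C A : Type*} [AddCommGroup C] [Module ℂ C] [Ring A] [Algebra ℂ A]
    (Δ : C →ₗ[ℂ] C ⊗[ℂ] C) (ε : C →ₗ[ℂ] ℂ) : List (C →ₗ[ℂ] A) → (C →ₗ[ℂ] A)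
  | [] => Algebra.linearMap ℂ A ∘ₗ ε
  | α :: l => LinearMap.mul' ℂ A ∘ₗ TensorProduct.map α (distribute Δ ε l) ∘ₗ Δ

/-! ## Oriented graphs embedded in an oriented surface -/

/-- The permutation `d ↦ next (opposite end of d)` of half-edges. -/
def turnPerm {E : Type*} (next : Equiv.Perm (E × Bool)) : Equiv.Perm (E × Bool) :=
  ((Equiv.refl E).prodCongr Equiv.boolNot).trans next

/-- An oriented graph with vertex set `V`, edge set `E` and face set `F` embedded in an oriented
surface, given by its rotation system. The half-edge `(e, false)` is the end of the oriented edge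
`e` at its origin, `(e, true)` is the end at its target, and `next` sends a half-edge to the
following one in counterclockwise order around their common vertex. Hence walking along a half-edge
`d` away from its vertex, and then turning into the half-edge `next` after the one we arrive by,
one goes around the face to the right of `d` in clockwise order.

`vertex d` is the vertex at `d`, and `face d` is the face to the right of `d` (seen when leaving
the vertex). For a cellulation of a closed surface both are always defined; the value `none`
allows for surfaces with boundary, with dangling edge ends and with holes in place of faces.
Loops, multiple edges, edges with the same face on both sides and isolated vertices are allowed. -/
structure EmbeddedGraph (V E F : Type*) where
  next : Equiv.Perm (E × Bool)
  vertex : E × Bool → Option V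
  face : E × Bool → Option F
  vertex_next : ∀ d, vertex (next d) = vertex d
  sameCycle_of_vertex : ∀ d d' v, vertex d = some v → vertex d' = some v → next.SameCycle d d'
  face_turn : ∀ d, face (turnPerm next d) = face d
  sameCycle_of_face : ∀ d d' p, face d = some p → face d' = some p →
    (turnPerm next).SameCycle d d'

/-- The list `d, f d, f² d, …` running once through the cycle of `d`. -/
def cycleList {D : Type*} (f : Equiv.Perm D) (d : D) : List D :=
  List.iterate f d (Function.minimalPeriod f d)

namespace EmbeddedGraph

variable {V E F : Type*} (Γ : EmbeddedGraph V E F)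

/-- One step in clockwise order around the face to the right of a half-edge. -/
def turn : Equiv.Perm (E × Bool) := turnPerm Γ.next

open Classical in
/-- The half-edges at the vertex `s` in counterclockwise order, from some starting point. -/
def vertexList (s : V) : List (E × Bool) :=
  if hs : ∃ d, Γ.vertex d = some s then cycleList Γ.next hs.choose else []

open Classical in
/-- The half-edges around the face `p` in clockwise order, from some starting point. -/
def faceList (p : F) : List (E × Bool) :=
  if hp : ∃ d, Γ.face d = some p then cycleList Γ.turn hp.choose else []

/-- The set `E(s)` of edges at the vertex `s`. -/
def edgesAtVertex (s : V) : Set E := {e | ∃ b, Γ.vertex (e, b) = some s}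

/-- The set `E(p)` of edges in the boundary of the face `p`. -/
def edgesAtFace (p : F) : Set E := {e | ∃ b, Γ.face (e, b) = some p}

end EmbeddedGraph

/-! ## Hilbert space and Hamiltonian -/

section Model

variable {V E F : Type*} (H : Type*) [NormedRing H] [StarRing H] [HopfAlgebra ℂ H]

variable (E) in
/-- The space `⨂_{e ∈ E} H`. -/
abbrev StateSpace : Type _ := ⨂[ℂ] _e : E, H

variable (E) in
/-- The involution of `⨂_{e ∈ E} H`, with `(⨂ x_e)* = ⨂ x_e*`. -/
def starMap [HopfCStarAlgebra H] : StateSpace E H →+ StateSpace E H :=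
  PiTensorProduct.liftAddHom
    (fun q => conj q.1 • PiTensorProduct.tprod ℂ (fun e => star (q.2 e)))
    (by
      intro r f i hi
      rw [(PiTensorProduct.tprod ℂ).map_coord_zero i (by simp [hi]), smul_zero])
    (by intro f; simp)
    (by
      intro _ r f i x y
      have hu : ∀ z : H, (fun e => star (Function.update f i z e)) =
          Function.update (fun e => star (f e)) i (star z) := fun z => by
        ext e; by_cases he : e = i <;> simp [he]
      simp only [hu, star_add, MultilinearMap.map_update_add, smul_add])
    (by intro r r' f; simp [add_smul])
    (by
      intro _ r f i r'
      have hu : ∀ z : H, (fun e => star (Function.update f i z e)) =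
          Function.update (fun e => star (f e)) i (star z) := fun z => by
        ext e; by_cases he : e = i <;> simp [he]
      simp only [hu, star_smul, MultilinearMap.map_update_smul, Function.update_eq_self]
      simp [smul_smul, mul_comm])

lemma starMap_tprod [HopfCStarAlgebra H] (x : E → H) :
    starMap E H (PiTensorProduct.tprod ℂ x) = PiTensorProduct.tprod ℂ (fun e => star (x e)) := by
  rw [← one_smul ℂ (PiTensorProduct.tprod ℂ x), ← PiTensorProduct.tprodCoeff_eq_smul_tprod]
  change conj (1 : ℂ) • PiTensorProduct.tprod ℂ (fun e => star (x e)) = _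
  simp

/-- The involution of `⨂_{e ∈ E} H` is conjugate-linear. -/
lemma starMap_smul [HopfCStarAlgebra H] (c : ℂ) (x : StateSpace E H) :
    starMap E H (c • x) = conj c • starMap E H x := by
  induction x using PiTensorProduct.induction_on with
  | smul_tprod r x =>
    have h : ∀ a : ℂ, starMap E H (a • PiTensorProduct.tprod ℂ x) =
        conj a • PiTensorProduct.tprod ℂ (fun e => star (x e)) := fun a => by
      rw [← PiTensorProduct.tprodCoeff_eq_smul_tprod]
      rfl
    rw [smul_smul, h, h, smul_smul, map_mul]
  | add x y hx hy => rw [smul_add, map_add, map_add, hx, hy, smul_add]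

variable {H}

/-- The functional `⨂_{e ∈ E} φ` on `⨂_{e ∈ E} H`. -/
def tensorFunctional [Finite E] (φ : Module.Dual ℂ H) : Module.Dual ℂ (StateSpace E H) :=
  PiTensorProduct.dualDistrib (PiTensorProduct.tprod ℂ fun _ => φ)

/-- The inner product of `⨂_{e ∈ E} H`, where each factor `H` carries `(a, b)_H = φ(a* b)`. -/
def innerProd [HopfCStarAlgebra H] [Finite E] (φ : Module.Dual ℂ H) (x y : StateSpace E H) : ℂ :=
  tensorFunctional φ (starMap E H x * y)

/-- On product vectors the inner product is the product of the inner products of the factors. -/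
lemma innerProd_tprod [HopfCStarAlgebra H] [Fintype E] (φ : Module.Dual ℂ H) (x y : E → H) :
    innerProd φ (PiTensorProduct.tprod ℂ x) (PiTensorProduct.tprod ℂ y) =
      ∏ e, φ (star (x e) * y e) := by
  simp [innerProd, tensorFunctional, starMap_tprod]

/-- `innerProd φ` is a Hermitian inner product (it is linear in the second argument by
definition). -/
def IsInnerProduct [HopfCStarAlgebra H] (E : Type*) [Finite E] (φ : Module.Dual ℂ H) : Prop :=
  (∀ x y : StateSpace E H, conj (innerProd φ x y) = innerProd φ y x) ∧
    ∀ x : StateSpace E H, x ≠ 0 → 0 < (innerProd φ x x).re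

/-- `T` is Hermitian with respect to the inner product of `⨂_{e ∈ E} H`. -/
def IsHermitian [HopfCStarAlgebra H] [Finite E] (φ : Module.Dual ℂ H)
    (T : Module.End ℂ (StateSpace E H)) : Prop :=
  ∀ x y, innerProd φ (T x) y = innerProd φ x (T y)

/-- `T` acts on the tensor factors in `K` only: it is a linear combination of product operators
which are trivial outside `K`. -/
def IsSupportedOn (T : Module.End ℂ (StateSpace E H)) (K : Set E) : Prop :=
  T ∈ Submodule.span ℂ {P | ∃ t : E → Module.End ℂ H, (∀ e, e ∉ K → t e = LinearMap.id) ∧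
    P = PiTensorProduct.map t}

variable [DecidableEq E]

/-- The operator acting by `t` on the factor of the edge `e` and trivially on the others. -/
def onEdge (e : E) : Module.End ℂ H →ₗ[ℂ] Module.End ℂ (StateSpace E H) :=
  (PiTensorProduct.mapMultilinear ℂ (fun _ : E => H) (fun _ : E => H)).toLinearMap
    (fun _ => LinearMap.id) e

/-- The action of `H` at a half-edge: `L₊` if the edge points towards the vertex, `L₋` if it
points away from it. -/
def vertexAction (d : E × Bool) : H →ₗ[ℂ] Module.End ℂ (StateSpace E H) :=
  onEdge d.1 ∘ₗ (if d.2 then Lplus else Lminus)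

/-- The action of `X` along a half-edge `d` for the face to the right of `d`. Seen in the direction
of the edge, the face lies to the right if `d` is the origin of the edge, and then `T₊` acts; it
lies to the left if `d` is the target, and then `T₋` acts. -/
def faceAction [HopfCStarAlgebra H] (d : E × Bool) :
    Module.Dual ℂ H →ₗ[ℂ] Module.End ℂ (StateSpace E H) :=
  onEdge d.1 ∘ₗ (if d.2 then Tminus else Tplus)

/-- The operator `∑ L^{a⁽¹⁾} ⋯ L^{a⁽ʳ⁾}` acting on a list of half-edges. -/
def vertexOpOn (l : List (E × Bool)) : H →ₗ[ℂ] Module.End ℂ (StateSpace E H) :=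
  distribute Coalgebra.comul Coalgebra.counit (l.map vertexAction)

/-- The operator `∑ T^{f⁽¹⁾} ⋯ T^{f⁽ʳ⁾}` acting on a list of half-edges. -/
def faceOpOn [HopfCStarAlgebra H] (l : List (E × Bool)) :
    Module.Dual ℂ H →ₗ[ℂ] Module.End ℂ (StateSpace E H) :=
  distribute comulX counitX (l.map faceAction)

namespace EmbeddedGraph

variable (Γ : EmbeddedGraph V E F)

/-- The vertex operator `A_a(s, p)`. The site `(s, p)` is given by the half-edge `d` which follows
the corner of the face `p` at the vertex `s` in counterclockwise order around `s`, i.e. `d` is at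
`s` and has `p` to its right. The coproduct of `a` is distributed counterclockwise around `s`,
starting from the site. -/
def siteVertexOp (a : H) (d : E × Bool) : Module.End ℂ (StateSpace E H) :=
  vertexOpOn (cycleList Γ.next d) a

/-- The face operator `B_f(s, p)` at the site `(s, p)` given by the half-edge `d` at `s` with `p` to
its right. The coproduct of `f` in `X = (H^op)^*` is distributed clockwise around `p`, starting from
the site. -/
def siteFaceOp [HopfCStarAlgebra H] (f : Module.Dual ℂ H) (d : E × Bool) :
    Module.End ℂ (StateSpace E H) :=
  faceOpOn (cycleList Γ.turn d) f

/-- `A(s) = A_h(s, p)`, for some choice of the site. -/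
def A (h : H) (s : V) : Module.End ℂ (StateSpace E H) := vertexOpOn (Γ.vertexList s) h

/-- `B(p) = B_φ(s, p)`, for some choice of the site. -/
def B [HopfCStarAlgebra H] (φ : Module.Dual ℂ H) (p : F) : Module.End ℂ (StateSpace E H) :=
  faceOpOn (Γ.faceList p) φ

/-- The Hamiltonian `-∑ A(s) - ∑ B(p)`. -/
def hamiltonian [HopfCStarAlgebra H] [Fintype V] [Fintype F] (h : H) (φ : Module.Dual ℂ H) :
    Module.End ℂ (StateSpace E H) :=
  -(∑ s, Γ.A h s) - ∑ p, Γ.B φ p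

/-- The local terms `-A(s)` and `-B(p)` of the Hamiltonian. -/
def localTerm [HopfCStarAlgebra H] (h : H) (φ : Module.Dual ℂ H) :
    V ⊕ F → Module.End ℂ (StateSpace E H) :=
  Sum.elim (fun s => -Γ.A h s) (fun p => -Γ.B φ p)

/-- The sets of edges `E(s)` and `E(p)`. -/
def localSupport : V ⊕ F → Set E := Sum.elim Γ.edgesAtVertex Γ.edgesAtFace

end EmbeddedGraph

end Model

/-- `ψ` is a ground state of `T`: an eigenvector for a real eigenvalue which is the smallest one. -/
def IsGroundState {N : Type*} [AddCommGroup N] [Module ℂ N] (T : Module.End ℂ N) (ψ : N) : Prop :=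
  ψ ≠ 0 ∧ ∃ E₀ : ℝ, T ψ = (E₀ : ℂ) • ψ ∧ ∀ μ : ℂ, T.HasEigenvalue μ → E₀ ≤ μ.re

/-- `T = ∑ᵢ tᵢ` is frustration-free with terms `tᵢ`: the terms commute with each other, there is a
ground state of `T`, and every ground state of `T` is a ground state of every term `tᵢ`. -/
structure IsFrustrationFree {N ι : Type*} [AddCommGroup N] [Module ℂ N] [Fintype ι]
    (T : Module.End ℂ N) (t : ι → Module.End ℂ N) : Prop where
  eq_sum : T = ∑ i, t i
  commute : ∀ i j, Commute (t i) (t j)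
  exists_groundState : ∃ ψ, IsGroundState T ψ
  groundState_term : ∀ ψ, IsGroundState T ψ → ∀ i, IsGroundState (t i) ψ

end

end QuantumDouble

/-!
Apart from the commutation of `A(s)` with `B(p)` and the existence of common fixed vectors, the
properties of the operators follow from two facts: the actions at distinct half-edges commute, and
`h` and `φ` are cocommutative self-adjoint idempotents of `H` and of `X = (H^op)^*`.
Cocommutativity makes the operators independent of the starting point of the cyclic lists
(`distribute_rotate`), idempotence makes them projectors (`distribute_mul`), and self-adjointness
makes them Hermitian (`distribute_adjoint`).

*Positivity, cocommutativity.* These need `S² = id` (`IsHaarFunctional.antipode_antipode`). Let `τ`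
be the character of the regular representation, a faithful positive trace because `H` is a
`C*`-algebra. The element `K = (τ ⊗ id) Δ(h)` satisfies `x K = K S²(x)`, and it is a sum of squares
because `Δ(h)` is a projector. Invariance of `φ` gives `S⁴ = id`, so `v = S²(x) - x` satisfies
`S²(v) = -v`, and `v K = - K v`. Then `τ(v* K v)` and `τ(v K v*) = -τ(v* K v)` are both nonnegative,
hence `K v = 0`, and nondegeneracy of `Δ(h)` gives `v = 0`. It follows that `φ` is a trace,
equal to the normalised `τ`; so it is positive, and `h` is cocommutative.

*Commutation.* On one edge the operators `T^f` and `L^a` satisfy an exchange relation involving the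
pairing `u(a ⊗ f) = f(a)` or its convolution inverse. In the convolution ring of linear maps
`H ⊗ X → End(N)` these relations read `T_d L_d = u⁻¹ L_d T_d` at the same half-edge and
`T_d L_{d'} = L_{d'} T_d u` at opposite ends of an edge (`face_mul_vertex`). When the operators
around a face are moved past those around a vertex, each common corner contributes a factor `u` from
the edge by which the boundary of the face arrives, followed by `u⁻¹` from the edge by which it
leaves, and these cancel; only at a common starting point are the factors placed on the outside, and
there they conjugate the whole product by `u` (`prod_mul_prod`). Conjugation by the central-valued
map `u` has no effect on the value at the cocommutative element `h ⊗ φ` (`pairing_conj_apply`).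

*Ground states.* The vector `(∏ B(p)) (⨂ h)` is fixed by all `A(s)` and `B(p)`, and it does not
vanish: its inner product with `⨂ 1`, which is fixed by all `B(p)`, equals `φ(h) ^ |E| ≠ 0`
(`EmbeddedGraph.exists_fixed_vector`). Hence the minimum of the energy is attained exactly by the
common fixed vectors of all the projectors (`isGroundState_neg_sum_iff`).
-/

namespace QuantumDouble

noncomputable section

open Coalgebra HopfAlgebra WithConv

/-! ### Haar integral and Haar functional -/

lemma sum_counit_smul_left {C ι : Type*} [AddCommGroup C] [Module ℂ C] [Coalgebra ℂ C] {x : C}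
    (r : Repr ℂ x ι) : ∑ i ∈ r.index, counit (R := ℂ) (r.right i) • r.left i = x := by
  have := congrArg (TensorProduct.rid ℂ C) (sum_tmul_counit_eq r)
  simpa only [map_sum, TensorProduct.rid_tmul, one_smul] using this

section HaarAlgebra

variable {H : Type*} [NormedRing H] [HopfAlgebra ℂ H]

/-- An algebra homomorphism has the convolution inverse `i ∘ S`. -/
lemma convMul_comp_antipode {A : Type*} [Ring A] [Algebra ℂ A] (i : H →ₐ[ℂ] A) :
    toConv i.toLinearMap * toConv (i.toLinearMap ∘ₗ antipode ℂ) = 1 := by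
  ext a
  rw [(ℛ ℂ a).convMul_apply]
  have h := congrArg i (sum_mul_antipode_eq_algebraMap_counit (ℛ ℂ a))
  simpa [map_sum] using h

lemma convMul_antipode_comp {A : Type*} [Ring A] [Algebra ℂ A] (i : H →ₐ[ℂ] A) :
    toConv (i.toLinearMap ∘ₗ antipode ℂ) * toConv i.toLinearMap = 1 := by
  ext a
  rw [(ℛ ℂ a).convMul_apply]
  have h := congrArg i (sum_antipode_mul_eq_algebraMap_counit (ℛ ℂ a))
  simpa [map_sum] using h

variable (H) in
/-- The inclusion `a ↦ a ⊗ 1`. -/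
abbrev inclLeft : H →ₐ[ℂ] H ⊗[ℂ] H := Algebra.TensorProduct.includeLeft

variable (H) in
/-- The inclusion `a ↦ 1 ⊗ a`. -/
abbrev inclRight : H →ₐ[ℂ] H ⊗[ℂ] H := Algebra.TensorProduct.includeRight

/-- The comultiplication is the convolution product of the two inclusions `H → H ⊗ H`. -/
lemma inclLeft_convMul_inclRight :
    toConv (inclLeft H).toLinearMap * toConv (inclRight H).toLinearMap =
      toConv (comul (R := ℂ) (A := H)) := by
  ext a
  rw [(ℛ ℂ a).convMul_apply]
  simp [(ℛ ℂ a).eq]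

/-- The antipode reverses the comultiplication: in the convolution ring of linear maps
`H → H ⊗ H`, where `Δ` is the product of the two inclusions, the right hand side is the product in
reverse order of the inverses of the inclusions. -/
lemma comul_antipode (a : H) :
    comul (R := ℂ) (antipode ℂ a) =
      TensorProduct.map (antipode ℂ) (antipode ℂ) (TensorProduct.comm ℂ H H (comul (R := ℂ) a)) := by
  let G : H →ₗ[ℂ] H ⊗[ℂ] H := TensorProduct.map (antipode ℂ) (antipode ℂ) ∘ₗ
    (TensorProduct.comm ℂ H H).toLinearMap ∘ₗ comul
  have hG : toConv ((inclRight H).toLinearMap ∘ₗ antipode ℂ) *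
      toConv ((inclLeft H).toLinearMap ∘ₗ antipode ℂ) = toConv G := by
    ext a
    rw [(ℛ ℂ a).convMul_apply]
    simp [G, ← (ℛ ℂ a).eq]
  have hinv : toConv G * toConv (comul (R := ℂ) (A := H)) = 1 := by
    rw [← hG, ← inclLeft_convMul_inclRight, mul_assoc,
      ← mul_assoc (toConv ((inclLeft H).toLinearMap ∘ₗ antipode ℂ)), convMul_antipode_comp, one_mul,
      convMul_antipode_comp]
  have h := left_inv_eq_right_inv hinv LinearMap.comul_right_inv
  exact (congrArg (fun f : WithConv (H →ₗ[ℂ] H ⊗[ℂ] H) => f a) h).symm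

/-- A Sweedler representation of `Δ(S(a))`. -/
def antipodeRepr {ι : Type*} {a : H} (r : Repr ℂ a ι) : Repr ℂ (antipode ℂ a) ι where
  index := r.index
  left i := antipode ℂ (r.right i)
  right i := antipode ℂ (r.left i)
  eq := by rw [comul_antipode, ← r.eq]; simp

variable {ι κ : Type*} {φ : Module.Dual ℂ H}

/-- A Sweedler representation of `Δ(x y) = Δ(x) Δ(y)`. -/
def mulRepr {x y : H} (r : Repr ℂ x ι) (s : Repr ℂ y κ) : Repr ℂ (x * y) (ι × κ) where
  index := r.index ×ˢ s.index
  left i := r.left i.1 * s.left i.2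
  right i := r.right i.1 * s.right i.2
  eq := by
    rw [Bialgebra.comul_mul, ← r.eq, ← s.eq, Finset.sum_mul_sum, Finset.sum_product]
    simp

lemma IsHaarFunctional.sum_smul_right (hφ : IsHaarFunctional φ) {x : H} (r : Repr ℂ x ι) :
    ∑ i ∈ r.index, φ (r.left i) • r.right i = φ x • (1 : H) := by
  rw [← (hφ.1 x).2, ← r.eq]; simp

lemma IsHaarFunctional.sum_smul_left (hφ : IsHaarFunctional φ) {x : H} (r : Repr ℂ x ι) :
    ∑ i ∈ r.index, φ (r.right i) • r.left i = φ x • (1 : H) := by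
  rw [← (hφ.1 x).1, ← r.eq]; simp

/-- `∑ φ(x' y) x'' = ∑ φ(x y') S(y'')`. -/
lemma IsHaarFunctional.sum_left_mul (hφ : IsHaarFunctional φ) {x y : H} (r : Repr ℂ x ι)
    (s : Repr ℂ y κ) :
    ∑ i ∈ r.index, φ (r.left i * y) • r.right i =
      ∑ j ∈ s.index, φ (x * s.left j) • antipode ℂ (s.right j) := by
  -- As functions of `y`, the left hand side `β` satisfies `β * id = γ` for the convolution product,
  -- by invariance of `φ`; convolving with the antipode gives `β = γ * S`.
  let β : H →ₗ[ℂ] H := ∑ i ∈ r.index, (φ ∘ₗ LinearMap.mulLeft ℂ (r.left i)).smulRight (r.right i)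
  let γ : H →ₗ[ℂ] H := (φ ∘ₗ LinearMap.mulLeft ℂ x).smulRight 1
  have h : toConv β * toConv LinearMap.id = toConv γ := by
    ext z
    rw [(ℛ ℂ z).convMul_apply]
    have := hφ.sum_smul_right (mulRepr r (ℛ ℂ z))
    simp only [mulRepr, Finset.sum_product] at this
    rw [Finset.sum_comm] at this
    simpa [β, γ, Finset.sum_mul] using this
  have h' : toConv β = toConv γ * toConv (antipode ℂ) := by
    rw [← h, mul_assoc, LinearMap.id_mul_antipode, mul_one]
  have := congrArg (fun f : WithConv (H →ₗ[ℂ] H) => f y) h'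
  rw [s.convMul_apply] at this
  simpa [β, γ] using this

/-- `∑ φ(x y'') y' = ∑ φ(x'' y) S(x')`. -/
lemma IsHaarFunctional.sum_mul_right (hφ : IsHaarFunctional φ) {x y : H} (r : Repr ℂ x ι)
    (s : Repr ℂ y κ) :
    ∑ j ∈ s.index, φ (x * s.right j) • s.left j =
      ∑ i ∈ r.index, φ (r.right i * y) • antipode ℂ (r.left i) := by
  let β : H →ₗ[ℂ] H :=
    ∑ j ∈ s.index, (φ ∘ₗ LinearMap.mulRight ℂ (s.right j)).smulRight (s.left j)
  let γ : H →ₗ[ℂ] H := (φ ∘ₗ LinearMap.mulRight ℂ y).smulRight 1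
  have h : toConv LinearMap.id * toConv β = toConv γ := by
    ext z
    rw [(ℛ ℂ z).convMul_apply]
    have := hφ.sum_smul_left (mulRepr (ℛ ℂ z) s)
    simp only [mulRepr, Finset.sum_product] at this
    simpa [β, γ, Finset.mul_sum] using this
  have h' : toConv β = toConv (antipode ℂ) * toConv γ := by
    rw [← h, ← mul_assoc, LinearMap.antipode_mul_id, one_mul]
  have := congrArg (fun f : WithConv (H →ₗ[ℂ] H) => f x) h'
  rw [r.convMul_apply] at this
  simpa [β, γ] using this

variable {h : H}

/-- `∑ φ(x h') S(h'') = φ(h) x`. -/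
lemma IsHaarFunctional.sum_mul_integral_left (hφ : IsHaarFunctional φ) (hh : IsHaarIntegral h)
    (r : Repr ℂ h ι) (x : H) :
    ∑ i ∈ r.index, φ (x * r.left i) • antipode ℂ (r.right i) = φ h • x := by
  rw [← hφ.sum_left_mul (ℛ ℂ x) r]
  simp only [(hh.1 _).1, map_smul, smul_eq_mul]
  conv_rhs => rw [← sum_counit_smul (ℛ ℂ x)]
  simp [Finset.smul_sum, smul_smul, mul_comm]

/-- `∑ φ(h' y) h'' = φ(h) S(y)`. -/
lemma IsHaarFunctional.sum_integral_left_mul (hφ : IsHaarFunctional φ) (hh : IsHaarIntegral h)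
    (r : Repr ℂ h ι) (y : H) :
    ∑ i ∈ r.index, φ (r.left i * y) • r.right i = φ h • antipode ℂ y := by
  rw [hφ.sum_left_mul r (ℛ ℂ y)]
  simp only [(hh.1 _).2, map_smul, smul_eq_mul]
  conv_rhs => rw [← sum_counit_smul (ℛ ℂ y)]
  simp [Finset.smul_sum, smul_smul, mul_comm]

/-- `∑ φ(x h'') h' = φ(h) S(x)`. -/
lemma IsHaarFunctional.sum_mul_integral_right (hφ : IsHaarFunctional φ) (hh : IsHaarIntegral h)
    (r : Repr ℂ h ι) (x : H) :
    ∑ i ∈ r.index, φ (x * r.right i) • r.left i = φ h • antipode ℂ x := by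
  rw [hφ.sum_mul_right (ℛ ℂ x) r]
  simp only [(hh.1 _).1, map_smul, smul_eq_mul]
  conv_rhs => rw [← sum_counit_smul_left (ℛ ℂ x)]
  simp [Finset.smul_sum, smul_smul, mul_comm]

/-- The trace formula `φ(h) Tr(f) = ∑ φ(f(S(h'')) h')`. -/
lemma IsHaarFunctional.mul_trace [FiniteDimensional ℂ H] (hφ : IsHaarFunctional φ)
    (hh : IsHaarIntegral h) (r : Repr ℂ h ι) (f : H →ₗ[ℂ] H) :
    φ h * LinearMap.trace ℂ H f =
      ∑ i ∈ r.index, φ (f (antipode ℂ (r.right i)) * r.left i) := by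
  have h1 : φ h • f = ∑ i ∈ r.index, (φ ∘ₗ LinearMap.mulRight ℂ (r.left i)).smulRight
      (f (antipode ℂ (r.right i))) := by
    ext x
    have := congrArg f (hφ.sum_mul_integral_left hh r x)
    simpa [map_sum] using this.symm
  have := congrArg (LinearMap.trace ℂ H) h1
  simpa [LinearMap.trace_smulRight] using this

/-- `(1 ⊗ x) Δ(h) = (S(x) ⊗ 1) Δ(h)`. -/
lemma IsHaarIntegral.tmul_mul_comul (hh : IsHaarIntegral h) (x : H) :
    ((1 : H) ⊗ₜ[ℂ] x) * comul (R := ℂ) h = (antipode ℂ x ⊗ₜ[ℂ] (1 : H)) * comul (R := ℂ) h := by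
  have h1 : toConv ((inclLeft H).toLinearMap ∘ₗ antipode ℂ) * toConv (comul (R := ℂ) (A := H)) =
      toConv (inclRight H).toLinearMap := by
    rw [← inclLeft_convMul_inclRight, ← mul_assoc, convMul_antipode_comp, one_mul]
  have h2 := congrArg (fun f : WithConv (H →ₗ[ℂ] H ⊗[ℂ] H) => f x * comul (R := ℂ) h) h1
  simp only [(ℛ ℂ x).convMul_apply, Finset.sum_mul, mul_assoc] at h2
  simp only [← Bialgebra.comul_mul, (hh.1 _).1, map_smul, mul_smul_comm] at h2
  simp only [← smul_mul_assoc, ← Finset.sum_mul, ← map_smul, ← map_sum,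
    sum_counit_smul_left] at h2
  exact h2.symm

/-- `Δ(h) (x ⊗ 1) = Δ(h) (1 ⊗ S(x))`. -/
lemma IsHaarIntegral.comul_mul_tmul (hh : IsHaarIntegral h) (x : H) :
    comul (R := ℂ) h * (x ⊗ₜ[ℂ] (1 : H)) = comul (R := ℂ) h * ((1 : H) ⊗ₜ[ℂ] antipode ℂ x) := by
  have h1 : toConv (comul (R := ℂ) (A := H)) * toConv ((inclRight H).toLinearMap ∘ₗ antipode ℂ) =
      toConv (inclLeft H).toLinearMap := by
    rw [← inclLeft_convMul_inclRight, mul_assoc, convMul_comp_antipode, mul_one]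
  have h2 := congrArg (fun f : WithConv (H →ₗ[ℂ] H ⊗[ℂ] H) => comul (R := ℂ) h * f x) h1
  simp only [(ℛ ℂ x).convMul_apply, Finset.mul_sum, ← mul_assoc] at h2
  simp only [← Bialgebra.comul_mul, (hh.1 _).2, map_smul, smul_mul_assoc] at h2
  simp only [← mul_smul_comm, ← Finset.mul_sum, ← map_smul, ← map_sum, sum_counit_smul] at h2
  exact h2.symm

/-- The slice map `ω ⊗ id`. -/
def slice (ω : Module.Dual ℂ H) : H ⊗[ℂ] H →ₗ[ℂ] H :=
  (TensorProduct.lid ℂ H).toLinearMap ∘ₗ ω.rTensor H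

@[simp] lemma slice_tmul (ω : Module.Dual ℂ H) (a b : H) : slice ω (a ⊗ₜ b) = ω a • b := by
  simp [slice]

lemma slice_one_tmul_mul (ω : Module.Dual ℂ H) (x : H) (D : H ⊗[ℂ] H) :
    slice ω (((1 : H) ⊗ₜ[ℂ] x) * D) = x * slice ω D := by
  induction D with
  | zero => simp
  | tmul a b => simp
  | add D D' h h' => simp [mul_add, h, h']

lemma slice_mul_one_tmul (ω : Module.Dual ℂ H) (x : H) (D : H ⊗[ℂ] H) :
    slice ω (D * ((1 : H) ⊗ₜ[ℂ] x)) = slice ω D * x := by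
  induction D with
  | zero => simp
  | tmul a b => simp
  | add D D' h h' => simp [add_mul, h, h']

lemma slice_tmul_one_mul (ω : Module.Dual ℂ H) (x : H) (D : H ⊗[ℂ] H) :
    slice ω ((x ⊗ₜ[ℂ] (1 : H)) * D) = slice (ω ∘ₗ LinearMap.mulLeft ℂ x) D := by
  induction D with
  | zero => simp
  | tmul a b => simp
  | add D D' h h' => simp [mul_add, h, h']

lemma slice_mul_tmul_one (ω : Module.Dual ℂ H) (x : H) (D : H ⊗[ℂ] H) :
    slice ω (D * (x ⊗ₜ[ℂ] (1 : H))) = slice (ω ∘ₗ LinearMap.mulRight ℂ x) D := by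
  induction D with
  | zero => simp
  | tmul a b => simp
  | add D D' h h' => simp [add_mul, h, h']

variable (H) in
/-- The character of the regular representation of `H`. -/
def regularTrace : Module.Dual ℂ H := LinearMap.trace ℂ H ∘ₗ LinearMap.mul ℂ H

lemma regularTrace_mul_comm (a b : H) : regularTrace H (a * b) = regularTrace H (b * a) := by
  have hm : ∀ a b : H, LinearMap.mul ℂ H (a * b) = LinearMap.mul ℂ H a * LinearMap.mul ℂ H b :=
    fun a b => by ext; simp [mul_assoc]
  simp only [regularTrace, LinearMap.comp_apply, hm]
  exact LinearMap.trace_mul_comm ℂ _ _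

/-- With `K = (τ ⊗ id) Δ(h)` one has `x K = K S²(x)`. -/
lemma IsHaarIntegral.mul_slice (hh : IsHaarIntegral h) (x : H) :
    x * slice (regularTrace H) (comul (R := ℂ) h) =
      slice (regularTrace H) (comul (R := ℂ) h) * antipode ℂ (antipode ℂ x) := by
  rw [← slice_one_tmul_mul, hh.tmul_mul_comul, slice_tmul_one_mul, ← slice_mul_one_tmul,
    ← hh.comul_mul_tmul, slice_mul_tmul_one]
  congr 2
  ext y
  exact regularTrace_mul_comm _ _

end HaarAlgebra

section HaarStar

variable {H : Type*} [NormedRing H] [StarRing H] [HopfAlgebra ℂ H] [HopfCStarAlgebra H]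
variable {ι : Type*} {φ : Module.Dual ℂ H} {h : H}

lemma antipode_injective : Function.Injective (antipode ℂ (A := H)) :=
  Function.LeftInverse.injective antipodeInv_antipode

lemma sum_antipodeInv_mul {x : H} (r : Repr ℂ x ι) :
    ∑ i ∈ r.index, antipodeInv H (r.right i) * r.left i = counit (R := ℂ) x • (1 : H) := by
  apply antipode_injective
  simp only [map_sum, antipode_mul_antidistrib, antipode_antipodeInv, map_smul, antipode_one]
  exact sum_antipode_mul_eq_smul r

/-- The trace formula for `f = S⁻²` reads `φ(h) Tr(S⁻²) = φ(∑ S⁻¹(h'') h') = 1`. -/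
lemma IsHaarFunctional.apply_integral_ne_zero (hφ : IsHaarFunctional φ) (hh : IsHaarIntegral h) :
    φ h ≠ 0 := by
  intro h0
  have h1 := hφ.mul_trace hh (ℛ ℂ h) (antipodeInv H ∘ₗ antipodeInv H)
  have h2 := congrArg φ (sum_antipodeInv_mul (ℛ ℂ h))
  rw [map_sum] at h2
  simp [h0, antipodeInv_antipode, h2, hh.2, hφ.2] at h1

/-- Both sides multiplied by `φ(h)` are equal to `∑ φ(x h'') φ(h' y)`. -/
lemma IsHaarFunctional.mul_antipode (hφ : IsHaarFunctional φ) (hh : IsHaarIntegral h) (x y : H) :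
    φ (x * antipode ℂ y) = φ (antipode ℂ x * y) := by
  have h1 := congrArg (fun z => φ (x * z)) (hφ.sum_integral_left_mul hh (ℛ ℂ h) y)
  have h2 := congrArg (fun z => φ (z * y)) (hφ.sum_mul_integral_right hh (ℛ ℂ h) x)
  simp only [Finset.mul_sum, Finset.sum_mul, map_sum, mul_smul_comm, smul_mul_assoc, map_smul,
    smul_eq_mul] at h1 h2
  refine mul_left_cancel₀ (hφ.apply_integral_ne_zero hh) ?_
  rw [← h1, ← h2]
  exact Finset.sum_congr rfl fun i _ => mul_comm _ _

lemma IsHaarFunctional.antipode (hφ : IsHaarFunctional φ) (hh : IsHaarIntegral h) (x : H) :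
    φ (antipode ℂ x) = φ x := by
  simpa using hφ.mul_antipode hh 1 x

lemma IsHaarFunctional.faithful (hφ : IsHaarFunctional φ) (hh : IsHaarIntegral h) {x : H}
    (hx : ∀ y, φ (x * y) = 0) : x = 0 := by
  have := hφ.sum_mul_integral_left hh (ℛ ℂ h) x
  simpa [hx, hφ.apply_integral_ne_zero hh] using this.symm

/-- The Nakayama automorphism of `φ` is the square of the antipode. -/
lemma IsHaarFunctional.mul_comm_antipode (hφ : IsHaarFunctional φ) (hh : IsHaarIntegral h)
    (x y : H) : φ (x * y) = φ (HopfAlgebra.antipode ℂ (HopfAlgebra.antipode ℂ y) * x) := by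
  obtain ⟨z, rfl⟩ : ∃ z, x = HopfAlgebra.antipode ℂ z := ⟨_, (antipode_antipodeInv x).symm⟩
  rw [← hφ.mul_antipode hh, ← hφ.antipode hh, antipode_mul_antidistrib]

/-- The fourth power of the antipode is the identity, since `φ` is invariant on both sides. -/
lemma IsHaarFunctional.antipode_pow_four (hφ : IsHaarFunctional φ) (hh : IsHaarIntegral h)
    (x : H) :
    HopfAlgebra.antipode ℂ (HopfAlgebra.antipode ℂ
      (HopfAlgebra.antipode ℂ (HopfAlgebra.antipode ℂ x))) = x := by
  rw [← sub_eq_zero]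
  refine hφ.faithful hh fun y => ?_
  rw [sub_mul, map_sub, sub_eq_zero, ← hφ.mul_comm_antipode hh, hφ.mul_antipode hh,
    hφ.mul_antipode hh, ← hφ.mul_comm_antipode hh]

end HaarStar

/-! ### Positivity and involutivity of the antipode -/

section PositiveFunctionals

open scoped ComplexOrder

/-- In a finite-dimensional `C*`-algebra the trace of left multiplication is positive and faithful:
the eigenvalues of multiplication by `a* a` belong to the spectrum of `a* a`. -/
lemma trace_mul_star_mul_self_pos {A : Type*} [CStarAlgebra A] [FiniteDimensional ℂ A] {a : A}
    (ha : a ≠ 0) : 0 < LinearMap.trace ℂ A (LinearMap.mul ℂ A (star a * a)) := by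
  set b := star a * a with hb
  have hsa : IsSelfAdjoint b := IsSelfAdjoint.star_mul_self a
  set T : Module.End ℂ A := LinearMap.mul ℂ A b
  have hspec : spectrum ℂ T = spectrum ℂ b := by
    ext μ
    rw [spectrum.mem_iff, spectrum.mem_iff, not_iff_not,
      ← Algebra.lmul_isUnit_iff (R := ℂ) (x := _ - b), map_sub,
      AlgHom.commutes]
    rfl
  have hroot : ∀ μ, μ ∈ T.charpoly.roots ↔ μ ∈ spectrum ℂ b := by
    intro μ
    rw [Polynomial.mem_roots (LinearMap.charpoly_monic T).ne_zero,
      ← Module.End.mem_spectrum_iff_isRoot_charpoly, hspec]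
  have hnn : ∀ μ ∈ spectrum ℂ b, 0 ≤ μ := by
    intro μ hμ
    have h1 := hsa.mem_spectrum_eq_re hμ
    rw [h1] at hμ ⊢
    have h2 : μ.re ∈ spectrum ℝ b := (spectrum.algebraMap_mem_iff ℂ).1 hμ
    exact_mod_cast spectrum_star_mul_self_nonneg _ h2
  have htr : LinearMap.trace ℂ A T = T.charpoly.roots.sum :=
    Module.End.trace_eq_sum_roots_charpoly_of_splits (IsAlgClosed.splits _)
  have hnn' : ∀ μ ∈ T.charpoly.roots, 0 ≤ μ := fun μ hμ => hnn μ ((hroot μ).1 hμ)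
  rw [htr]
  refine lt_of_le_of_ne (Multiset.sum_nonneg hnn') fun h0 => ha ?_
  have hz : ∀ μ ∈ spectrum ℂ b, μ = 0 := fun μ hμ =>
    Multiset.all_zero_of_le_zero_le_of_sum_eq_zero hnn' h0.symm _ ((hroot μ).2 hμ)
  have hr := hsa.spectralRadius_eq_nnnorm
  have hr0 : spectralRadius ℂ b = 0 := by
    simp only [spectralRadius, ENNReal.iSup_eq_zero]
    intro μ hμ
    simp [hz μ hμ]
  rw [hr0] at hr
  have hb0 : b = 0 := by simpa using hr.symm
  simpa [hb, CStarRing.star_mul_self_eq_zero_iff] using hb0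

variable {A : Type*} [Ring A] [StarRing A] [Algebra ℂ A] [StarModule ℂ A]

/-- A positive functional is compatible with the involution. -/
lemma apply_star_of_nonneg (ω : Module.Dual ℂ A) (hω : ∀ a, 0 ≤ ω (star a * a)) (a : A) :
    ω (star a) = conj (ω a) := by
  have him : ∀ a, (ω (star a * a)).im = 0 := fun a => ((Complex.nonneg_iff.1 (hω a)).2).symm
  have h1 := him (1 + a)
  have h2 := him (1 + Complex.I • a)
  have h0 := him 1
  have ha := him a
  simp only [star_add, star_one, star_smul, add_mul, mul_add, mul_one, one_mul, map_add,
    Complex.add_im, smul_mul_assoc, mul_smul_comm, map_smul, smul_eq_mul] at h0 h1 h2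
  simp at h2
  apply Complex.ext
  · simp; linarith
  · simp; linarith

/-- The scalar product `(a, b) = ω(a* b)` given by a faithful positive functional. -/
@[reducible]
def innerCore (ω : Module.Dual ℂ A) (hω : ∀ a, a ≠ 0 → 0 < ω (star a * a)) :
    InnerProductSpace.Core ℂ A where
  inner a b := ω (star a * b)
  conj_inner_symm a b := by
    have hω' : ∀ a, 0 ≤ ω (star a * a) := fun a => by
      by_cases ha : a = 0
      · simp [ha]
      · exact (hω a ha).le
    rw [← apply_star_of_nonneg ω hω']
    simp
  re_inner_nonneg a := by
    by_cases ha : a = 0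
    · simp [ha]
    · exact (Complex.nonneg_iff.1 (hω a ha).le).1
  add_left a b c := by simp [add_mul]
  smul_left a b r := by simp
  definite a ha := by
    by_contra h
    exact (hω a h).ne' ha

lemma exists_orthonormal_basis_of_core {W : Type*} [AddCommGroup W] [Module ℂ W]
    [FiniteDimensional ℂ W] (c : InnerProductSpace.Core ℂ W) :
    ∃ b : Module.Basis (Fin (Module.finrank ℂ W)) ℂ W,
      ∀ i j, c.inner (b i) (b j) = if i = j then 1 else 0 := by
  let := c.toNormedAddCommGroup
  let := InnerProductSpace.ofCore c.toCore
  refine ⟨(stdOrthonormalBasis ℂ W).toBasis, fun i j => ?_⟩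
  have := orthonormal_iff_ite.1 (stdOrthonormalBasis ℂ W).orthonormal i j
  simpa using this

/-- A faithful positive functional `ω` has a basis which is orthonormal for `(a, b) = ω(a* b)`. -/
lemma exists_orthonormal_basis [FiniteDimensional ℂ A] (ω : Module.Dual ℂ A)
    (hω : ∀ a, a ≠ 0 → 0 < ω (star a * a)) :
    ∃ b : Module.Basis (Fin (Module.finrank ℂ A)) ℂ A,
      ∀ i j, ω (star (b i) * b j) = if i = j then 1 else 0 :=
  exists_orthonormal_basis_of_core (innerCore ω hω)

end PositiveFunctionals

section Involutive

open scoped ComplexOrder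

variable {H : Type*} [NormedRing H] [StarRing H] [HopfAlgebra ℂ H] [HopfCStarAlgebra H]
variable {ι : Type*} {φ : Module.Dual ℂ H} {h : H}

lemma regularTrace_pos {a : H} (ha : a ≠ 0) : 0 < regularTrace H (star a * a) := by
  let : NormedAlgebra ℂ H := { norm_smul_le := fun r x => (norm_smul r x).le }
  have : CompleteSpace H := FiniteDimensional.complete ℂ H
  let : CStarAlgebra H := {}
  exact trace_mul_star_mul_self_pos ha

/-- The Haar integral is self-adjoint, since `h* h = ε(h*) h = h`. -/
lemma IsHaarIntegral.star_eq (hh : IsHaarIntegral h) : star h = h := by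
  have h1 : star h * h = h := by simp [(hh.1 _).1, counit_star, hh.2]
  have h2 := congrArg star h1
  rw [star_mul, star_star, h1] at h2
  exact h2.symm

omit [HopfCStarAlgebra H] in
/-- Expansion of an element of `H ⊗ H` in an orthonormal basis of the first factor. -/
lemma eq_sum_tmul_slice {κ : Type*} [Fintype κ] [DecidableEq κ] {ω : Module.Dual ℂ H}
    (b : Module.Basis κ ℂ H) (hb : ∀ i j, ω (star (b i) * b j) = if i = j then 1 else 0)
    (D : H ⊗[ℂ] H) :
    D = ∑ n, b n ⊗ₜ[ℂ] slice (ω ∘ₗ LinearMap.mulLeft ℂ (star (b n))) D := by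
  have hrepr : ∀ a n, ω (star (b n) * a) = b.repr a n := by
    intro a n
    conv_lhs => rw [← b.sum_repr a]
    simp only [Finset.mul_sum, map_sum, mul_smul_comm, map_smul, hb]
    simp
  induction D with
  | zero => simp
  | tmul a c =>
    conv_lhs => rw [← b.sum_repr a, TensorProduct.sum_tmul]
    simp [hrepr, ← TensorProduct.smul_tmul']
  | add D D' h h' =>
    conv_lhs => rw [h, h', ← Finset.sum_add_distrib]
    simp [TensorProduct.tmul_add]

/-- `K = (τ ⊗ id) Δ(h)` is a sum of squares, since `Δ(h) = Δ(h)* Δ(h)`. -/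
lemma IsHaarIntegral.exists_slice_eq (hh : IsHaarIntegral h) :
    ∃ c : Fin (Module.finrank ℂ H) → H,
      slice (regularTrace H) (comul (R := ℂ) h) = ∑ n, star (c n) * c n := by
  obtain ⟨b, hb⟩ := exists_orthonormal_basis (regularTrace H) fun a ha => regularTrace_pos ha
  refine ⟨fun n => slice (regularTrace H ∘ₗ LinearMap.mulLeft ℂ (star (b n))) (comul (R := ℂ) h), ?_⟩
  have h1 : comul (R := ℂ) h = star (comul (R := ℂ) h) * comul (R := ℂ) h := by
    rw [← HopfCStarAlgebra.comul_star, hh.star_eq, ← Bialgebra.comul_mul, (hh.1 h).1, hh.2,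
      one_smul]
  conv_lhs => rw [h1, eq_sum_tmul_slice b hb (comul (R := ℂ) h)]
  simp [star_sum, Finset.sum_mul_sum, hb]

/-- The antipode of a finite-dimensional Hopf `C*`-algebra is involutive. If `S²(v) = -v`, then
`K = (τ ⊗ id) Δ(h)` satisfies `v K = - K v`. As `K` is a sum of squares and `τ` is a faithful
positive trace, this is only possible if `K v = 0`, and then `v = 0`. As `S⁴ = id`, every
`S²(x) - x` is such a vector `v`. -/
lemma IsHaarFunctional.antipode_antipode (hφ : IsHaarFunctional φ) (hh : IsHaarIntegral h) (x : H) :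
    HopfAlgebra.antipode ℂ (HopfAlgebra.antipode ℂ x) = x := by
  set τ := regularTrace H
  set v := HopfAlgebra.antipode ℂ (HopfAlgebra.antipode ℂ x) - x with hv
  have hSv : HopfAlgebra.antipode ℂ (HopfAlgebra.antipode ℂ v) = -v := by
    simp [hv, hφ.antipode_pow_four hh]
  set K := slice τ (comul (R := ℂ) h) with hK
  have hvK : v * K = -(K * v) := by rw [hh.mul_slice v, hSv, mul_neg]
  obtain ⟨c, hc⟩ := hh.exists_slice_eq
  have hnn : ∀ a : H, 0 ≤ τ (star a * a) := fun a => by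
    by_cases ha : a = 0
    · simp [ha]
    · exact (regularTrace_pos ha).le
  have hsq : ∀ w : H, τ (star w * K * w) = ∑ n, τ (star (c n * w) * (c n * w)) := by
    intro w
    rw [hK, hc]
    simp [Finset.mul_sum, Finset.sum_mul, mul_assoc]
  have hKv0 : τ (star v * K * v) = 0 := by
    have h1 : 0 ≤ τ (star v * K * v) := by
      rw [hsq]; exact Finset.sum_nonneg fun n _ => hnn _
    have h2 : 0 ≤ τ (v * K * star v) := by
      have := hsq (star v)
      rw [star_star] at this
      rw [this]; exact Finset.sum_nonneg fun n _ => hnn _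
    have h3 : τ (v * K * star v) = -τ (star v * K * v) := by
      rw [hvK, neg_mul, map_neg, regularTrace_mul_comm, mul_assoc]
    rw [h3] at h2
    exact le_antisymm (neg_nonneg.1 h2) h1
  have hcv : ∀ n, c n * v = 0 := by
    intro n
    rw [hsq, Finset.sum_eq_zero_iff_of_nonneg fun n _ => hnn _] at hKv0
    by_contra hne
    exact (regularTrace_pos hne).ne' (hKv0 n (Finset.mem_univ n))
  have hKv : K * v = 0 := by
    rw [hK, hc, Finset.sum_mul]
    exact Finset.sum_eq_zero fun n _ => by rw [mul_assoc, hcv, mul_zero]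
  obtain ⟨y, hy⟩ : ∃ y, v = HopfAlgebra.antipode ℂ y := ⟨_, (antipode_antipodeInv v).symm⟩
  have hzero : y = 0 := by
    by_contra hne
    rw [hy, hK, ← slice_mul_one_tmul, ← hh.comul_mul_tmul, slice_mul_tmul_one, ← (ℛ ℂ h).eq] at hKv
    -- Contracting with `φ(z ·)`, where `S(z) = y*`, turns `(τ(· y) ⊗ id) Δ(h) = 0` into
    -- `τ(y* y) = 0`.
    have h1 := congrArg (fun w => φ (antipodeInv H (star y) * w)) hKv
    have h2 := congrArg (fun w => τ (w * y))
      (hφ.sum_mul_integral_right hh (ℛ ℂ h) (antipodeInv H (star y)))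
    simp only [map_sum, slice_tmul, Finset.mul_sum, Finset.sum_mul, mul_smul_comm, smul_mul_assoc,
      map_smul, smul_eq_mul, antipode_antipodeInv, LinearMap.comp_apply,
      LinearMap.mulRight_apply, mul_zero, map_zero] at h1 h2
    have h3 : φ h * τ (star y * y) = 0 := by
      rw [← h2, ← h1]
      exact Finset.sum_congr rfl fun i _ => mul_comm _ _
    exact (mul_ne_zero (hφ.apply_integral_ne_zero hh) (regularTrace_pos hne).ne') h3
  rw [hzero, map_zero, hv, sub_eq_zero] at hy
  exact hy

lemma IsHaarFunctional.antipodeInv_eq (hφ : IsHaarFunctional φ) (hh : IsHaarIntegral h) :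
    antipodeInv H = HopfAlgebra.antipode ℂ := by
  ext x
  apply antipode_injective
  rw [antipode_antipodeInv, hφ.antipode_antipode hh]

/-- The Haar functional is a trace. -/
lemma IsHaarFunctional.mul_comm (hφ : IsHaarFunctional φ) (hh : IsHaarIntegral h) (x y : H) :
    φ (x * y) = φ (y * x) := by
  rw [hφ.mul_comm_antipode hh, hφ.antipode_antipode hh]

/-- The Haar functional is the normalised character of the regular representation. -/
lemma IsHaarFunctional.eq_regularTrace (hφ : IsHaarFunctional φ) (hh : IsHaarIntegral h) (x : H) :
    φ x = φ h * regularTrace H x := by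
  have h1 := congrArg (fun z => φ (x * z)) (sum_antipodeInv_mul (ℛ ℂ h))
  rw [hφ.antipodeInv_eq hh] at h1
  have h2 := hφ.mul_trace hh (ℛ ℂ h) (LinearMap.mul ℂ H x)
  simp only [Finset.mul_sum, map_sum, hh.2, one_smul, mul_one, ← mul_assoc] at h1
  rw [← h1]
  exact h2.symm

lemma IsHaarFunctional.pos (hφ : IsHaarFunctional φ) (hh : IsHaarIntegral h) {a : H} (ha : a ≠ 0) :
    0 < φ (star a * a) := by
  have : Nontrivial H := ⟨1, 0, fun h10 => by simpa [h10] using hφ.2⟩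
  have h1 : 0 < regularTrace H (1 : H) := by simpa using regularTrace_pos (one_ne_zero (α := H))
  have h2 : φ h * regularTrace H (1 : H) = 1 := by rw [← hφ.eq_regularTrace hh, hφ.2]
  have h3 : φ h = (regularTrace H (1 : H))⁻¹ := eq_inv_of_mul_eq_one_left h2
  rw [hφ.eq_regularTrace hh, h3]
  exact mul_pos (inv_pos.2 h1) (regularTrace_pos ha)

lemma IsHaarFunctional.apply_star (hφ : IsHaarFunctional φ) (hh : IsHaarIntegral h) (a : H) :
    φ (star a) = conj (φ a) := by
  refine apply_star_of_nonneg φ (fun a => ?_) a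
  by_cases ha : a = 0
  · simp [ha]
  · exact (hφ.pos hh ha).le

/-- The Haar integral is cocommutative: both sides have the slices `φ(h) S(x)` under
`φ(x ·) ⊗ id`. -/
lemma IsHaarFunctional.comm_comul_integral (hφ : IsHaarFunctional φ) (hh : IsHaarIntegral h) :
    TensorProduct.comm ℂ H H (comul (R := ℂ) h) = comul (R := ℂ) h := by
  obtain ⟨b, hb⟩ := exists_orthonormal_basis φ fun a ha => hφ.pos hh ha
  have key : ∀ x, slice (φ ∘ₗ LinearMap.mulLeft ℂ x) (TensorProduct.comm ℂ H H (comul (R := ℂ) h)) =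
      slice (φ ∘ₗ LinearMap.mulLeft ℂ x) (comul (R := ℂ) h) := by
    intro x
    have h1 := hφ.sum_mul_integral_right hh (ℛ ℂ h) x
    have h2 := congrArg (HopfAlgebra.antipode ℂ) (hφ.sum_mul_integral_left hh (ℛ ℂ h) x)
    simp only [map_sum, map_smul, hφ.antipode_antipode hh] at h2
    rw [← h1] at h2
    conv_lhs => rw [← (ℛ ℂ h).eq]
    conv_rhs => rw [← (ℛ ℂ h).eq]
    simpa using h2.symm
  rw [eq_sum_tmul_slice b hb (TensorProduct.comm ℂ H H (comul (R := ℂ) h))]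
  simp_rw [key]
  exact (eq_sum_tmul_slice b hb _).symm

end Involutive

/-! ### Distributing a coproduct over a list, and the dual coalgebra -/

section Distribute

variable {C A : Type*} [AddCommGroup C] [Module ℂ C] [Coalgebra ℂ C] [Ring A] [Algebra ℂ A]
variable {ι : Type*}

@[simp] lemma distribute_nil_apply (c : C) :
    distribute comul counit ([] : List (C →ₗ[ℂ] A)) c = algebraMap ℂ A (counit c) := rfl

lemma distribute_cons_apply (α : C →ₗ[ℂ] A) (l : List (C →ₗ[ℂ] A)) {c : C} (r : Repr ℂ c ι) :
    distribute comul counit (α :: l) c =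
      ∑ i ∈ r.index, α (r.left i) * distribute comul counit l (r.right i) := by
  simp [distribute, ← r.eq]

/-- Distributing the coproduct over a list is multiplying in the convolution ring. -/
lemma toConv_distribute (l : List (C →ₗ[ℂ] A)) :
    toConv (distribute comul counit l) = (l.map toConv).prod := by
  induction l with
  | nil => rfl
  | cons α l ih => rw [List.map_cons, List.prod_cons, ← ih]; rfl

/-- The images of `∑ α₁(c⁽¹⁾) ⋯ α_r(c⁽ʳ⁾)` lie in every subalgebra containing the images of
the `αᵢ`. -/
lemma distribute_mem (S : Subalgebra ℂ A) (l : List (C →ₗ[ℂ] A)) (hl : ∀ α ∈ l, ∀ c, α c ∈ S)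
    (c : C) : distribute comul counit l c ∈ S := by
  induction l generalizing c with
  | nil => exact S.algebraMap_mem _
  | cons α l ih =>
    rw [distribute_cons_apply α l (ℛ ℂ c)]
    exact S.sum_mem fun i _ => S.mul_mem (hl α (by simp) _)
      (ih (fun β hβ => hl β (by simp [hβ])) _)

lemma commute_distribute {a : A} (l : List (C →ₗ[ℂ] A)) (hl : ∀ α ∈ l, ∀ c, Commute a (α c))
    (c : C) : Commute a (distribute comul counit l c) := by
  have h := distribute_mem (Subalgebra.centralizer ℂ {a}) l (fun α hα c => by
    simpa [Subalgebra.mem_centralizer_iff] using (hl α hα c).eq) c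
  exact Subalgebra.mem_centralizer_iff ℂ |>.1 h a rfl

/-- Convolution products of maps with commuting images may be reversed when evaluated at a
cocommutative element. -/
lemma convMul_apply_comm {α β : WithConv (C →ₗ[ℂ] A)} {c : C}
    (hc : TensorProduct.comm ℂ C C (comul (R := ℂ) c) = comul (R := ℂ) c)
    (hcomm : ∀ x y, Commute (α x) (β y)) : (α * β) c = (β * α) c := by
  let s : Repr ℂ c (C × C) :=
    { index := (ℛ ℂ c).index
      left := (ℛ ℂ c).right
      right := (ℛ ℂ c).left
      eq := by rw [← hc, ← (ℛ ℂ c).eq]; simp }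
  rw [(ℛ ℂ c).convMul_apply, s.convMul_apply]
  exact Finset.sum_congr rfl fun i _ => (hcomm _ _).eq

/-- On a cocommutative element the distribution of the coproduct over a list of maps with
commuting images is invariant under cyclic rotation. -/
lemma distribute_rotate {α : C →ₗ[ℂ] A} {l : List (C →ₗ[ℂ] A)} {c : C}
    (hc : TensorProduct.comm ℂ C C (comul (R := ℂ) c) = comul (R := ℂ) c)
    (hl : ∀ β ∈ l, ∀ x y, Commute (α x) (β y)) :
    distribute comul counit (l ++ [α]) c = distribute comul counit (α :: l) c := by
  have h := convMul_apply_comm (α := toConv α) (β := toConv (distribute comul counit l)) hc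
    fun x y => commute_distribute l (fun β hβ y => hl β hβ x y) y
  have h1 : toConv (distribute comul counit (l ++ [α])) =
      toConv (distribute comul counit l) * toConv α := by simp [toConv_distribute]
  have h2 : toConv (distribute comul counit (α :: l)) =
      toConv α * toConv (distribute comul counit l) := by simp [toConv_distribute]
  rw [← h1, ← h2] at h
  exact h.symm

/-- If the maps `αᵢ` are multiplicative with commuting images, then so is
`c ↦ ∑ α₁(c⁽¹⁾) ⋯ α_r(c⁽ʳ⁾)`, for any product on `C` which is compatible with the coalgebra
structure. -/
lemma distribute_mul (μ : C → C → C)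
    (hμ : ∀ a b, comul (R := ℂ) (μ a b) = ∑ i ∈ (ℛ ℂ a).index, ∑ j ∈ (ℛ ℂ b).index,
      μ ((ℛ ℂ a).left i) ((ℛ ℂ b).left j) ⊗ₜ[ℂ] μ ((ℛ ℂ a).right i) ((ℛ ℂ b).right j))
    (hε : ∀ a b, counit (R := ℂ) (μ a b) = counit (R := ℂ) a * counit (R := ℂ) b)
    (l : List (C →ₗ[ℂ] A)) (hl : ∀ α ∈ l, ∀ a b, α (μ a b) = α a * α b)
    (hcomm : l.Pairwise fun α β => ∀ a b, Commute (α a) (β b)) (a b : C) :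
    distribute comul counit l (μ a b) =
      distribute comul counit l a * distribute comul counit l b := by
  induction l generalizing a b with
  | nil => simp [hε]
  | cons α l ih =>
    rw [List.pairwise_cons] at hcomm
    let s : Repr ℂ (μ a b) ((C × C) × (C × C)) :=
      { index := (ℛ ℂ a).index ×ˢ (ℛ ℂ b).index
        left := fun i => μ ((ℛ ℂ a).left i.1) ((ℛ ℂ b).left i.2)
        right := fun i => μ ((ℛ ℂ a).right i.1) ((ℛ ℂ b).right i.2)
        eq := by rw [hμ, Finset.sum_product] }
    rw [distribute_cons_apply α l (ℛ ℂ a), distribute_cons_apply α l (ℛ ℂ b),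
      distribute_cons_apply α l s, Finset.sum_mul_sum, Finset.sum_product]
    refine Finset.sum_congr rfl fun i _ => Finset.sum_congr rfl fun j _ => ?_
    change α (μ _ _) * distribute comul counit l (μ _ _) = _
    rw [hl α (by simp), ih (fun β hβ => hl β (by simp [hβ])) hcomm.2]
    have := commute_distribute (a := α ((ℛ ℂ b).left j)) l
      (fun β hβ c => hcomm.1 β hβ _ c) ((ℛ ℂ a).right i)
    simp only [mul_assoc]
    rw [← mul_assoc (α ((ℛ ℂ b).left j)), this.eq, mul_assoc]

/-- Adjoints of `∑ α₁(c⁽¹⁾) ⋯ α_r(c⁽ʳ⁾)`. The relation `adj x y` says that `y` is adjoint to `x`;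
if `αᵢ(σ c)` is adjoint to `αᵢ(c)` for a conjugation `σ` of the coalgebra `C`, and the images of
the `αᵢ` commute, then the same holds for the distributed map. -/
lemma distribute_adjoint (adj : A → A → Prop) (h0 : adj 0 0)
    (hadd : ∀ {x x' y y'}, adj x x' → adj y y' → adj (x + y) (x' + y'))
    (hmul : ∀ {x x' y y'}, adj x x' → adj y y' → adj (x * y) (y' * x'))
    (halg : ∀ z : ℂ, adj (algebraMap ℂ A z) (algebraMap ℂ A (conj z)))
    (σ : C → C)
    (hσ : ∀ c, comul (R := ℂ) (σ c) =
      ∑ i ∈ (ℛ ℂ c).index, σ ((ℛ ℂ c).left i) ⊗ₜ[ℂ] σ ((ℛ ℂ c).right i))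
    (hε : ∀ c, counit (R := ℂ) (σ c) = conj (counit (R := ℂ) c))
    (l : List (C →ₗ[ℂ] A)) (hl : ∀ α ∈ l, ∀ c, adj (α c) (α (σ c)))
    (hcomm : l.Pairwise fun α β => ∀ a b, Commute (α a) (β b)) (c : C) :
    adj (distribute comul counit l c) (distribute comul counit l (σ c)) := by
  induction l generalizing c with
  | nil => simpa [hε] using halg (counit c)
  | cons α l ih =>
    rw [List.pairwise_cons] at hcomm
    let s : Repr ℂ (σ c) (C × C) :=
      { index := (ℛ ℂ c).index
        left := fun i => σ ((ℛ ℂ c).left i)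
        right := fun i => σ ((ℛ ℂ c).right i)
        eq := (hσ c).symm }
    rw [distribute_cons_apply α l (ℛ ℂ c), distribute_cons_apply α l s]
    have hsum : ∀ (t : Finset (C × C)) (f g : C × C → A), (∀ i, adj (f i) (g i)) →
        adj (∑ i ∈ t, f i) (∑ i ∈ t, g i) := by
      intro t f g hfg
      classical
      induction t using Finset.induction_on with
      | empty => simpa using h0
      | insert i t hi ht => rw [Finset.sum_insert hi, Finset.sum_insert hi]; exact hadd (hfg i) ht
    refine hsum _ _ _ fun i => ?_
    have := commute_distribute (a := α (σ ((ℛ ℂ c).left i))) l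
      (fun β hβ c => hcomm.1 β hβ _ c) (σ ((ℛ ℂ c).right i))
    change adj _ (α (σ _) * distribute comul counit l (σ _))
    rw [this.eq]
    exact hmul (hl α (by simp) _) (ih (fun β hβ => hl β (by simp [hβ])) hcomm.2 _)

end Distribute

section Dual

variable {H : Type*} [NormedRing H] [StarRing H] [HopfAlgebra ℂ H] [HopfCStarAlgebra H]
variable {ι : Type*}

open TensorProduct (dualDistrib)

lemma dualDistrib_comulX (f : Module.Dual ℂ H) (x y : H) :
    dualDistrib ℂ H H (comulX f) (x ⊗ₜ y) = f (y * x) := by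
  have : dualDistrib ℂ H H (comulX f) =
      Module.Dual.transpose (R := ℂ)
        (LinearMap.mul' ℂ H ∘ₗ (TensorProduct.comm ℂ H H).toLinearMap) f :=
    (TensorProduct.dualDistribEquiv ℂ H H).apply_symm_apply _
  rw [this]
  simp [Module.Dual.transpose_apply]

lemma dualDistrib_injective (M N : Type*) [AddCommGroup M] [Module ℂ M] [FiniteDimensional ℂ M]
    [AddCommGroup N] [Module ℂ N] [FiniteDimensional ℂ N] :
    Function.Injective (dualDistrib ℂ M N) :=
  (TensorProduct.dualDistribEquiv ℂ M N).injective

/-- Elements of `X ⊗ X` are determined by their pairing with `H ⊗ H`. -/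
lemma dual_tmul_ext {s t : Module.Dual ℂ H ⊗[ℂ] Module.Dual ℂ H}
    (hst : ∀ x y : H, dualDistrib ℂ H H s (x ⊗ₜ y) = dualDistrib ℂ H H t (x ⊗ₜ y)) : s = t := by
  apply dualDistrib_injective H H
  ext x y
  exact hst x y

/-- The coalgebra `X = (H^op)^*`. -/
instance : Coalgebra ℂ (Module.Dual ℂ H) where
  comul := comulX
  counit := counitX
  coassoc := by
    -- Both iterated coproducts of `f` pair with `x ⊗ y ⊗ z` to `f(z y x)`.
    have hr : ∀ (s : Module.Dual ℂ H ⊗[ℂ] Module.Dual ℂ H) (g : Module.Dual ℂ H) (x y z : H),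
        dualDistrib ℂ H (H ⊗[ℂ] H) ((dualDistrib ℂ H H).lTensor (Module.Dual ℂ H)
          (TensorProduct.assoc ℂ _ _ _ (s ⊗ₜ g))) (x ⊗ₜ (y ⊗ₜ z)) =
          dualDistrib ℂ H H s (x ⊗ₜ y) * g z := by
      intro s g x y z
      induction s with
      | zero => simp
      | tmul a b => simp [mul_assoc]
      | add s s' h h' => simp only [TensorProduct.add_tmul, map_add, LinearMap.add_apply, h, h',
          add_mul]
    have hr' : ∀ (t : Module.Dual ℂ H ⊗[ℂ] Module.Dual ℂ H) (x y z : H),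
        dualDistrib ℂ H (H ⊗[ℂ] H) ((dualDistrib ℂ H H).lTensor (Module.Dual ℂ H)
          (TensorProduct.assoc ℂ _ _ _ (comulX.rTensor _ t))) (x ⊗ₜ (y ⊗ₜ z)) =
          dualDistrib ℂ H H t ((y * x) ⊗ₜ z) := by
      intro t x y z
      induction t with
      | zero => simp
      | tmul a b => rw [LinearMap.rTensor_tmul, hr, dualDistrib_comulX]; simp
      | add s s' h h' => simp only [map_add, LinearMap.add_apply, h, h']
    have hl : ∀ (t : Module.Dual ℂ H ⊗[ℂ] Module.Dual ℂ H) (x y z : H),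
        dualDistrib ℂ H (H ⊗[ℂ] H) ((dualDistrib ℂ H H).lTensor (Module.Dual ℂ H)
          (comulX.lTensor _ t)) (x ⊗ₜ (y ⊗ₜ z)) =
          dualDistrib ℂ H H t (x ⊗ₜ (z * y)) := by
      intro t x y z
      induction t with
      | zero => simp
      | tmul a b => simp [dualDistrib_comulX]
      | add s s' h h' => simp only [map_add, LinearMap.add_apply, h, h']
    have hinj : Function.Injective ((dualDistrib ℂ H H).lTensor (Module.Dual ℂ H)) :=
      (LinearEquiv.lTensor (Module.Dual ℂ H) (TensorProduct.dualDistribEquiv ℂ H H)).injective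
    ext f : 1
    apply hinj
    apply dualDistrib_injective H (H ⊗[ℂ] H)
    ext x y z
    simp only [LinearMap.comp_apply, LinearEquiv.coe_coe]
    simp [hr', hl, dualDistrib_comulX, mul_assoc]
  rTensor_counit_comp_comul := by
    have key : ∀ (t : Module.Dual ℂ H ⊗[ℂ] Module.Dual ℂ H) (y : H),
        TensorProduct.lid ℂ _ (counitX.rTensor _ t) y = dualDistrib ℂ H H t (1 ⊗ₜ y) := by
      intro t y
      induction t with
      | zero => simp
      | tmul a b => simp [counitX]
      | add s s' h h' => simp only [map_add, LinearMap.add_apply, h, h']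
    ext f : 1
    apply (TensorProduct.lid ℂ _).injective
    ext y
    simp [key, dualDistrib_comulX]
  lTensor_counit_comp_comul := by
    have key : ∀ (t : Module.Dual ℂ H ⊗[ℂ] Module.Dual ℂ H) (y : H),
        TensorProduct.rid ℂ _ (counitX.lTensor _ t) y = dualDistrib ℂ H H t (y ⊗ₜ 1) := by
      intro t y
      induction t with
      | zero => simp
      | tmul a b => simp [counitX, mul_comm]
      | add s s' h h' => simp only [map_add, LinearMap.add_apply, h, h']
    ext f : 1
    apply (TensorProduct.rid ℂ _).injective
    ext y
    simp [key, dualDistrib_comulX]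

lemma counit_dual (f : Module.Dual ℂ H) : counit (R := ℂ) f = f 1 := rfl

lemma dualDistrib_comul (f : Module.Dual ℂ H) (x y : H) :
    dualDistrib ℂ H H (comul (R := ℂ) f) (x ⊗ₜ y) = f (y * x) := dualDistrib_comulX f x y

/-- `∑ f'(x) f''(y) = f(y x)`. -/
lemma sum_apply_mul_apply {f : Module.Dual ℂ H} (r : Repr ℂ f ι) (x y : H) :
    ∑ j ∈ r.index, r.left j x * r.right j y = f (y * x) := by
  rw [← dualDistrib_comul, ← r.eq]
  simp

/-- The Haar functional is cocommutative, because it is a trace. -/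
lemma IsHaarFunctional.comm_comul {φ : Module.Dual ℂ H} (hφ : IsHaarFunctional φ) {h : H}
    (hh : IsHaarIntegral h) :
    TensorProduct.comm ℂ _ _ (comul (R := ℂ) φ) = comul (R := ℂ) φ := by
  apply dual_tmul_ext
  intro x y
  rw [dualDistrib_comul, hφ.mul_comm hh, ← dualDistrib_comul, ← (ℛ ℂ φ).eq]
  simp only [map_sum, TensorProduct.comm_tmul, LinearMap.sum_apply,
    TensorProduct.dualDistrib_apply]
  exact Finset.sum_congr rfl fun i _ => _root_.mul_comm _ _

/-- The product of `X`, dual to the comultiplication of `H`: `(f g)(x) = ∑ f(x') g(x'')`. -/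
def dualMul (f g : Module.Dual ℂ H) : Module.Dual ℂ H :=
  (toConv f * toConv g).ofConv

omit [StarRing H] [HopfCStarAlgebra H] in
lemma dualMul_apply (f g : Module.Dual ℂ H) {x : H} (r : Repr ℂ x ι) :
    dualMul f g x = ∑ i ∈ r.index, f (r.left i) * g (r.right i) :=
  r.convMul_apply (toConv f) (toConv g)

lemma comul_dualMul (f g : Module.Dual ℂ H) :
    comul (R := ℂ) (dualMul f g) = ∑ i ∈ (ℛ ℂ f).index, ∑ j ∈ (ℛ ℂ g).index,
      dualMul ((ℛ ℂ f).left i) ((ℛ ℂ g).left j) ⊗ₜ[ℂ]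
        dualMul ((ℛ ℂ f).right i) ((ℛ ℂ g).right j) := by
  apply dual_tmul_ext
  intro x y
  have hL := dualMul_apply f g (mulRepr (ℛ ℂ y) (ℛ ℂ x))
  simp only [mulRepr, ← sum_apply_mul_apply (ℛ ℂ f), ← sum_apply_mul_apply (ℛ ℂ g),
    Finset.sum_product, Finset.sum_mul_sum] at hL
  rw [dualDistrib_comul, hL]
  simp only [map_sum, LinearMap.sum_apply, TensorProduct.dualDistrib_apply,
    dualMul_apply _ _ (ℛ ℂ x), dualMul_apply _ _ (ℛ ℂ y), Finset.sum_mul_sum]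
  refine Finset.sum_comm.trans ((Finset.sum_congr rfl fun _ _ => Finset.sum_comm).trans
    (Finset.sum_comm.trans (Finset.sum_congr rfl fun i _ =>
      (Finset.sum_congr rfl fun _ _ => Finset.sum_comm).trans (Finset.sum_comm.trans
        (Finset.sum_congr rfl fun j _ => Finset.sum_congr rfl fun q _ =>
          Finset.sum_congr rfl fun p _ => ?_)))))
  ring

/-- The involution `f*(x) = conj f(S(x)*)` of the dual of `H`. -/
def dualStar (f : Module.Dual ℂ H) : Module.Dual ℂ H where
  toFun x := conj (f (star (antipode ℂ x)))
  map_add' x y := by simp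
  map_smul' c x := by simp

lemma comul_dualStar (f : Module.Dual ℂ H) :
    comul (R := ℂ) (dualStar f) = ∑ i ∈ (ℛ ℂ f).index,
      dualStar ((ℛ ℂ f).left i) ⊗ₜ[ℂ] dualStar ((ℛ ℂ f).right i) := by
  apply dual_tmul_ext
  intro x y
  rw [dualDistrib_comul]
  have := sum_apply_mul_apply (ℛ ℂ f) (star (antipode ℂ x)) (star (antipode ℂ y))
  simp [dualStar, antipode_mul_antidistrib, ← this]

lemma counit_dualStar (f : Module.Dual ℂ H) :
    counit (R := ℂ) (dualStar f) = conj (counit (R := ℂ) f) := by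
  simp [counit_dual, dualStar]

end Dual

/-! ### Cycles of half-edges and the cancellation at corners -/

section CycleList

variable {D : Type*} (f : Equiv.Perm D) (d : D)

lemma length_cycleList : (cycleList f d).length = Function.minimalPeriod f d := by
  simp [cycleList]

lemma nodup_cycleList : (cycleList f d).Nodup := by
  rw [cycleList, ← List.range_map_iterate, List.nodup_map_iff_inj_on List.nodup_range]
  intro i hi j hj hij
  exact Function.iterate_injOn_Iio_minimalPeriod (by simpa using hi) (by simpa using hj) hij

lemma mem_periodicPts [Finite D] : d ∈ Function.periodicPts f :=
  f.injective.mem_periodicPts d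

lemma isChain_iterate (n : ℕ) (a : D) : (List.iterate f a n).IsChain fun x y => y = f x := by
  induction n generalizing a with
  | zero => simp
  | succ n ih =>
    cases n with
    | zero => simp
    | succ n => exact List.IsChain.cons_cons rfl (ih (f a))

lemma getLast_iterate (n : ℕ) (a : D) (h : List.iterate f a (n + 1) ≠ []) :
    f ((List.iterate f a (n + 1)).getLast h) = f^[n + 1] a := by
  rw [List.getLast_eq_getElem, List.getElem_iterate, ← Function.iterate_succ_apply' f]
  simp

/-- The list of a cycle starts at the given point, follows the permutation, and closes up. -/
lemma exists_cycleList_eq [Finite D] :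
    ∃ l, cycleList f d = d :: l ∧ (d :: l).IsChain (fun x y => y = f x) ∧
      f ((d :: l).getLast (List.cons_ne_nil _ _)) = d := by
  obtain ⟨n, hn⟩ : ∃ n, Function.minimalPeriod f d = n + 1 :=
    ⟨_, (Nat.succ_pred_eq_of_pos
      (Function.minimalPeriod_pos_of_mem_periodicPts (mem_periodicPts f d))).symm⟩
  refine ⟨List.iterate f (f d) n, ?_, ?_, ?_⟩
  · rw [cycleList, hn]; rfl
  · exact isChain_iterate f (n + 1) d
  · have := getLast_iterate f n d (by simp [List.iterate])
    exact this.trans (hn ▸ Function.iterate_minimalPeriod)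

lemma cycleList_apply [Finite D] {l : List D} (h : cycleList f d = d :: l) :
    cycleList f (f d) = l ++ [d] := by
  have hper := mem_periodicPts f d
  apply List.ext_getElem
  · have := congrArg List.length h
    rw [length_cycleList] at this
    rw [length_cycleList, Function.minimalPeriod_apply hper, this]
    simp
  · intro i h1 h2
    have hl : ∀ i (hi : i < l.length), l[i] = f^[i + 1] d := by
      intro i hi
      have : l[i] = (cycleList f d)[i + 1]'(by rw [h]; simpa using hi) := by simp [h]
      rw [this]
      simp [cycleList]
    have hlen := congrArg List.length h
    rw [length_cycleList] at hlen
    rw [List.getElem_append]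
    split_ifs with hi
    · rw [hl i hi]
      simp [cycleList]
    · have hil : i + 1 = Function.minimalPeriod f d := by
        simp only [List.length_append, List.length_singleton] at h2
        simp only [List.length_cons] at hlen
        omega
      simp only [cycleList, List.getElem_iterate, List.getElem_singleton]
      rw [← Function.iterate_succ_apply, Nat.succ_eq_add_one, hil, Function.iterate_minimalPeriod]

lemma sameCycle_of_mem_cycleList {d' : D} (h : d' ∈ cycleList f d) : f.SameCycle d d' := by
  obtain ⟨n, -, rfl⟩ := List.mem_iterate.1 h
  exact ⟨n, by rw [zpow_natCast, Equiv.Perm.iterate_eq_pow]⟩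

/-- A function of half-edges which is invariant under a permutation is constant on cycles. -/
lemma eq_of_sameCycle [Finite D] {β : Type*} {g : D → β} (hg : ∀ d, g (f d) = g d) {d d' : D}
    (h : f.SameCycle d d') : g d' = g d := by
  obtain ⟨n, rfl⟩ := h.exists_nat_pow_eq
  clear h
  induction n with
  | zero => simp
  | succ n ih => rw [pow_succ', Equiv.Perm.mul_apply, hg]; exact ih

end CycleList

section Words

variable {M D : Type*} [Monoid M] [DecidableEq D]

/-- The word `∏ u⁻¹^[d = e] L_d` over a list of half-edges `d`. -/
def cornerWord (u : Mˣ) (L : D → M) (e : D) (m : List D) : M :=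
  (m.map fun d => (if d = e then (↑u⁻¹ : M) else 1) * L d).prod

lemma cornerWord_of_notMem (u : Mˣ) (L : D → M) {e : D} {m : List D} (h : e ∉ m) :
    cornerWord u L e m = (m.map L).prod := by
  rw [cornerWord]
  congr 1
  refine List.map_congr_left fun d hd => ?_
  rw [if_neg fun hde : d = e => h (hde ▸ hd), one_mul]

lemma cornerWord_cons (u : Mˣ) (L : D → M) (e d : D) (m : List D) :
    cornerWord u L e (d :: m) =
      (if d = e then (↑u⁻¹ : M) else 1) * L d * cornerWord u L e m := by
  simp [cornerWord]

variable {u : Mˣ} {L T : D → M} {next flip : D → D}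

/-- Moving a face operator `T_e` past a chain of vertex operators. A factor `u` appears where the
chain passes the end of `e`, a factor `u⁻¹` where it passes the origin of `e`; at the corner where
the boundary of the face turns from `e` to `next (flip e)`, the first of these cancels the factor
`u⁻¹` belonging to the following edge. -/
lemma mul_cornerWord (hnext : Function.Injective next)
    (hT : ∀ e d, T e * L d =
      (if d = e then (↑u⁻¹ : M) else 1) * L d * T e * (if d = flip e then (u : M) else 1))
    (e d : D) (m : List D) (hm : (d :: m).IsChain fun x y => y = next x) :
    T e * (L d * cornerWord u L (next (flip e)) m) =
      cornerWord u L e (d :: m) * T e *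
        (if (d :: m).getLast (List.cons_ne_nil _ _) = flip e then (u : M) else 1) := by
  induction m generalizing d with
  | nil =>
    simp only [cornerWord, List.map_nil, List.prod_nil, mul_one, List.map_cons, List.prod_cons]
    exact hT e d
  | cons d₂ m ih =>
    rw [List.isChain_cons_cons] at hm
    have hcancel : (if d = flip e then (u : M) else 1) *
        (if d₂ = next (flip e) then (↑u⁻¹ : M) else 1) = 1 := by
      simp only [hm.1, hnext.eq_iff]
      split_ifs <;> simp
    calc T e * (L d * cornerWord u L (next (flip e)) (d₂ :: m))
        = (T e * L d) * ((if d₂ = next (flip e) then (↑u⁻¹ : M) else 1) *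
            (L d₂ * cornerWord u L (next (flip e)) m)) := by
          rw [cornerWord_cons]; simp only [mul_assoc]
      _ = (if d = e then (↑u⁻¹ : M) else 1) * L d * T e * ((if d = flip e then (u : M) else 1) *
            (if d₂ = next (flip e) then (↑u⁻¹ : M) else 1)) *
            (L d₂ * cornerWord u L (next (flip e)) m) := by
          rw [hT]; simp only [mul_assoc]
      _ = (if d = e then (↑u⁻¹ : M) else 1) * L d *
            (T e * (L d₂ * cornerWord u L (next (flip e)) m)) := by
          rw [hcancel]; simp only [mul_assoc, one_mul]
      _ = _ := by
          rw [ih d₂ hm.2, cornerWord_cons u L e d, List.getLast_cons (List.cons_ne_nil d₂ m)]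
          simp only [mul_assoc]

/-- The operators along a path `e :: l` in the boundary of a face, which ends at the corner `e₀`,
moved past the operators around a vertex. -/
lemma prod_mul_prod_aux (hnext : Function.Injective next)
    (hT : ∀ e d, T e * L d =
      (if d = e then (↑u⁻¹ : M) else 1) * L d * T e * (if d = flip e then (u : M) else 1))
    (d : D) (m : List D) (hm : (d :: m).IsChain fun x y => y = next x)
    (hm' : next ((d :: m).getLast (List.cons_ne_nil _ _)) = d)
    (e₀ e : D) (l : List D) (hl : (e :: l).IsChain fun x y => y = next (flip x))
    (hl' : next (flip ((e :: l).getLast (List.cons_ne_nil _ _))) = e₀)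
    (hd : d ∉ l) (he : e₀ ∉ m) :
    ((e :: l).map T).prod * ((d :: m).map L).prod =
      cornerWord u L e (d :: m) * ((e :: l).map T).prod * (if d = e₀ then (u : M) else 1) := by
  induction l generalizing e with
  | nil =>
    have h := mul_cornerWord hnext hT e d m hm
    simp only [List.getLast_singleton] at hl'
    rw [hl', cornerWord_of_notMem u L he] at h
    have hiff : (d :: m).getLast (List.cons_ne_nil _ _) = flip e ↔ d = e₀ := by
      rw [← hnext.eq_iff, hm', hl']
    simp only [hiff] at h
    simpa using h
  | cons e₂ l ih =>
    rw [List.isChain_cons_cons] at hl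
    rw [List.getLast_cons (List.cons_ne_nil e₂ l)] at hl'
    have hd₂ : d ≠ e₂ := fun h => hd (by simp [h])
    have h := mul_cornerWord hnext hT e d m hm
    have hlast : (d :: m).getLast (List.cons_ne_nil _ _) ≠ flip e := by
      -- Otherwise the starting corner `d` of the vertex would lie inside the path.
      intro h
      rw [h, ← hl.1] at hm'
      exact hd₂ hm'.symm
    rw [if_neg hlast, mul_one, ← hl.1] at h
    have ih' := ih e₂ hl.2 hl' fun h => hd (by simp [h])
    rw [cornerWord_cons u L e₂ d, if_neg hd₂, one_mul] at ih'
    rw [List.map_cons, List.prod_cons, mul_assoc, ih', ← mul_assoc, ← mul_assoc, h]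
    simp only [mul_assoc]

/-- Moving the operators around a face, listed clockwise, past the operators around a vertex, listed
counterclockwise, conjugates by `u` if both lists start at a common corner. The hypotheses say that
the two cycles have no corner in common except possibly the starting point of both; corners inside
the lists contribute factors which cancel. -/
lemma prod_mul_prod (hnext : Function.Injective next)
    (hT : ∀ e d, T e * L d =
      (if d = e then (↑u⁻¹ : M) else 1) * L d * T e * (if d = flip e then (u : M) else 1))
    (d : D) (m : List D) (hm : (d :: m).IsChain fun x y => y = next x)
    (hm' : next ((d :: m).getLast (List.cons_ne_nil _ _)) = d)
    (e : D) (l : List D) (hl : (e :: l).IsChain fun x y => y = next (flip x))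
    (hl' : next (flip ((e :: l).getLast (List.cons_ne_nil _ _))) = e)
    (hd : d ∉ l) (he : e ∉ m) :
    ∃ c : Mˣ, (c = 1 ∨ c = u) ∧ ((e :: l).map T).prod * ((d :: m).map L).prod =
      ↑c⁻¹ * (((d :: m).map L).prod * ((e :: l).map T).prod) * c := by
  have h := prod_mul_prod_aux hnext hT d m hm hm' e e l hl hl' hd he
  rw [cornerWord_cons, cornerWord_of_notMem u L he] at h
  by_cases hde : d = e
  · refine ⟨u, Or.inr rfl, ?_⟩
    rw [h, if_pos hde, if_pos hde]
    simp [mul_assoc]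
  · refine ⟨1, Or.inl rfl, ?_⟩
    rw [h, if_neg hde, if_neg hde]
    simp [mul_assoc]

end Words

/-! ### Actions on one edge -/

section SingleEdge

variable {H : Type*} [NormedRing H] [HopfAlgebra ℂ H]
variable {ι κ : Type*}

lemma Lplus_apply (a x : H) : Lplus a x = a * x := rfl

lemma Lminus_apply (a x : H) : Lminus a x = x * antipode ℂ a := rfl

lemma Tplus_apply (f : Module.Dual ℂ H) {x : H} (r : Repr ℂ x ι) :
    Tplus f x = ∑ i ∈ r.index, f (r.right i) • r.left i := by
  simp [Tplus, ← r.eq]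

lemma Lplus_mul (a b : H) : (Lplus (a * b) : Module.End ℂ H) = Lplus a * Lplus b := by
  ext x; simp [Lplus_apply, mul_assoc]

lemma Lminus_mul (a b : H) : (Lminus (a * b) : Module.End ℂ H) = Lminus a * Lminus b := by
  ext x; simp [Lminus_apply, mul_assoc, antipode_mul_antidistrib]

lemma commute_Lplus_Lminus (a b : H) : Commute (Lplus a : Module.End ℂ H) (Lminus b) := by
  ext x; simp [Lplus_apply, Lminus_apply, mul_assoc]

end SingleEdge

section SingleEdgeStar

variable {H : Type*} [NormedRing H] [StarRing H] [HopfAlgebra ℂ H] [HopfCStarAlgebra H]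
variable {ι κ : Type*} {φ : Module.Dual ℂ H} {h : H}

lemma Tminus_apply (f : Module.Dual ℂ H) {x : H} (r : Repr ℂ x ι) :
    Tminus f x = ∑ i ∈ r.index, f (antipodeInv H (r.left i)) • r.right i := by
  simp [Tminus, ← r.eq]

/-- A functional, regarded as a scalar-valued element of the convolution ring of `H`. -/
def scalarConv (f : Module.Dual ℂ H) : WithConv (H →ₗ[ℂ] H) := toConv (Algebra.linearMap ℂ H ∘ₗ f)

omit [StarRing H] [HopfCStarAlgebra H] in
lemma scalarConv_apply (f : Module.Dual ℂ H) (x : H) : scalarConv f x = f x • (1 : H) :=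
  Algebra.algebraMap_eq_smul_one _

omit [StarRing H] [HopfCStarAlgebra H] in
lemma scalarConv_dualMul (f g : Module.Dual ℂ H) :
    scalarConv (dualMul f g) = scalarConv f * scalarConv g := by
  ext x
  rw [(ℛ ℂ x).convMul_apply]
  simp only [scalarConv_apply, dualMul_apply f g (ℛ ℂ x), Finset.sum_smul]
  simp [smul_smul, mul_comm]

omit [StarRing H] [HopfCStarAlgebra H] in
/-- Composition with `T₊^f` is right convolution with `f`. -/
lemma comp_Tplus (P : H →ₗ[ℂ] H) (f : Module.Dual ℂ H) :
    toConv (P ∘ₗ Tplus f) = toConv P * scalarConv f := by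
  ext x
  rw [(ℛ ℂ x).convMul_apply]
  simp [Tplus_apply f (ℛ ℂ x), scalarConv_apply]

/-- Composition with `T₋^f` is left convolution with `f ∘ S⁻¹`. -/
lemma comp_Tminus (P : H →ₗ[ℂ] H) (f : Module.Dual ℂ H) :
    toConv (P ∘ₗ Tminus f) = scalarConv (f ∘ₗ antipodeInv H) * toConv P := by
  ext x
  rw [(ℛ ℂ x).convMul_apply]
  simp [Tminus_apply f (ℛ ℂ x), scalarConv_apply]

lemma antipodeInv_mul (x y : H) : antipodeInv H (x * y) = antipodeInv H y * antipodeInv H x := by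
  simp [antipodeInv, antipode_mul_antidistrib]

/-- A Sweedler representation of `Δ(S⁻¹(a))`. -/
def antipodeInvRepr {a : H} (r : Repr ℂ a ι) : Repr ℂ (antipodeInv H a) ι :=
  starRepr (antipodeRepr (starRepr r))

lemma dualMul_comp_antipodeInv (f g : Module.Dual ℂ H) :
    dualMul f g ∘ₗ antipodeInv H = dualMul (g ∘ₗ antipodeInv H) (f ∘ₗ antipodeInv H) := by
  ext x
  rw [LinearMap.comp_apply, dualMul_apply f g (antipodeInvRepr (ℛ ℂ x)),
    dualMul_apply _ _ (ℛ ℂ x)]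
  exact Finset.sum_congr rfl fun i _ => mul_comm _ _

omit [StarRing H] [HopfCStarAlgebra H] in
lemma Tplus_mul (f g : Module.Dual ℂ H) : (Tplus (dualMul f g) : Module.End ℂ H) =
    Tplus f * Tplus g := by
  apply toConv_injective
  have h := comp_Tplus (Tplus f) g
  have h₁ := comp_Tplus LinearMap.id f
  have h₂ := comp_Tplus LinearMap.id (dualMul f g)
  rw [LinearMap.id_comp] at h₁ h₂
  rw [Module.End.mul_eq_comp, h, h₁, h₂, scalarConv_dualMul, mul_assoc]

lemma Tminus_mul (f g : Module.Dual ℂ H) : (Tminus (dualMul f g) : Module.End ℂ H) =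
    Tminus f * Tminus g := by
  apply toConv_injective
  have h := comp_Tminus (Tminus f) g
  have h₁ := comp_Tminus LinearMap.id f
  have h₂ := comp_Tminus LinearMap.id (dualMul f g)
  rw [LinearMap.id_comp] at h₁ h₂
  rw [Module.End.mul_eq_comp, h, h₁, h₂, dualMul_comp_antipodeInv, scalarConv_dualMul, mul_assoc]

lemma commute_Tplus_Tminus (f g : Module.Dual ℂ H) :
    Commute (Tplus f : Module.End ℂ H) (Tminus g) := by
  apply toConv_injective
  have h₁ := comp_Tplus LinearMap.id f
  have h₂ := comp_Tminus LinearMap.id g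
  rw [LinearMap.id_comp] at h₁ h₂
  rw [Module.End.mul_eq_comp, Module.End.mul_eq_comp, comp_Tminus, comp_Tplus, h₁, h₂, mul_assoc]

/-! ### Adjoints of the actions on one edge -/

omit [HopfCStarAlgebra H] in
lemma apply_star_Lplus (φ : Module.Dual ℂ H) (a x y : H) :
    φ (star (Lplus a x) * y) = φ (star x * Lplus (star a) y) := by
  simp [Lplus_apply, mul_assoc]

lemma IsHaarFunctional.apply_star_Lminus (hφ : IsHaarFunctional φ) (hh : IsHaarIntegral h)
    (a x y : H) : φ (star (Lminus a x) * y) = φ (star x * Lminus (star a) y) := by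
  have hS : star (HopfAlgebra.antipode ℂ a) = HopfAlgebra.antipode ℂ (star a) := by
    rw [← LinearMap.congr_fun (hφ.antipodeInv_eq hh) (star a)]
    simp [antipodeInv]
  rw [Lminus_apply, Lminus_apply, star_mul, hS, mul_assoc, hφ.mul_comm hh, mul_assoc]

/-- The conjugate functional `x ↦ conj f(x*)`. -/
def dualConj (f : Module.Dual ℂ H) : Module.Dual ℂ H where
  toFun x := conj (f (star x))
  map_add' x y := by simp
  map_smul' c x := by simp

lemma IsHaarFunctional.apply_star_Tplus (hφ : IsHaarFunctional φ) (f : Module.Dual ℂ H)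
    (x y : H) : φ (star (Tplus f x) * y) = φ (star x * Tplus (dualStar f) y) := by
  have h := congrArg (dualConj f) (hφ.sum_left_mul (starRepr (ℛ ℂ x)) (ℛ ℂ y))
  rw [Tplus_apply f (ℛ ℂ x), Tplus_apply _ (ℛ ℂ y)]
  simpa [starRepr, dualConj, dualStar, star_sum, Finset.sum_mul, Finset.mul_sum,
    _root_.mul_comm] using h

lemma IsHaarFunctional.apply_star_Tminus (hφ : IsHaarFunctional φ) (f : Module.Dual ℂ H)
    (x y : H) : φ (star (Tminus f x) * y) = φ (star x * Tminus (dualStar f) y) := by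
  have h := congrArg (dualStar f ∘ₗ antipodeInv H)
    (hφ.sum_mul_right (starRepr (ℛ ℂ x)) (ℛ ℂ y)).symm
  simp only [LinearMap.comp_apply, map_sum, map_smul, antipodeInv_antipode] at h
  rw [Tminus_apply f (ℛ ℂ x), Tminus_apply _ (ℛ ℂ y)]
  simpa [starRepr, dualStar, antipodeInv, star_sum, Finset.sum_mul, Finset.mul_sum,
    _root_.mul_comm] using h

lemma IsHaarFunctional.dualStar_eq (hφ : IsHaarFunctional φ) (hh : IsHaarIntegral h) :
    dualStar φ = φ := by
  ext x
  simp [dualStar, hφ.apply_star hh, hφ.antipode hh]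

/-! ### Exchange relations on one edge -/

lemma Tplus_mul_Lplus {f : Module.Dual ℂ H} {a : H} (r : Repr ℂ a ι) (t : Repr ℂ f κ) :
    (Tplus f * Lplus a : Module.End ℂ H) = ∑ i ∈ r.index, ∑ j ∈ t.index,
      t.right j (r.right i) • (Lplus (r.left i) * Tplus (t.left j)) := by
  ext x
  simp only [Module.End.mul_apply, LinearMap.sum_apply, LinearMap.smul_apply, Lplus_apply]
  rw [Tplus_apply f (mulRepr r (ℛ ℂ x))]
  simp only [mulRepr, Finset.sum_product, ← sum_apply_mul_apply t, Tplus_apply _ (ℛ ℂ x),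
    Finset.sum_smul, Finset.mul_sum, Finset.smul_sum, mul_smul_comm, smul_smul]
  refine Finset.sum_congr rfl fun i _ => Finset.sum_comm.trans ?_
  simp only [mul_comm]

lemma Tminus_mul_Lminus {f : Module.Dual ℂ H} {a : H} (r : Repr ℂ a ι) (t : Repr ℂ f κ) :
    (Tminus f * Lminus a : Module.End ℂ H) = ∑ i ∈ r.index, ∑ j ∈ t.index,
      t.right j (r.right i) • (Lminus (r.left i) * Tminus (t.left j)) := by
  ext x
  simp only [Module.End.mul_apply, LinearMap.sum_apply, LinearMap.smul_apply, Lminus_apply]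
  rw [Tminus_apply f (mulRepr (ℛ ℂ x) (antipodeRepr r))]
  simp only [mulRepr, antipodeRepr, Finset.sum_product_right, antipodeInv_mul,
    antipodeInv_antipode, ← sum_apply_mul_apply t, Tminus_apply _ (ℛ ℂ x),
    Finset.sum_smul, Finset.sum_mul, Finset.smul_sum, smul_mul_assoc, smul_smul]
  refine Finset.sum_congr rfl fun i _ => Finset.sum_comm.trans ?_
  simp only [mul_comm]

lemma Tplus_mul_Lminus {f : Module.Dual ℂ H} {a : H} (r : Repr ℂ a ι) (t : Repr ℂ f κ) :
    (Tplus f * Lminus a : Module.End ℂ H) = ∑ i ∈ r.index, ∑ j ∈ t.index,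
      t.left j (antipode ℂ (r.left i)) • (Lminus (r.right i) * Tplus (t.right j)) := by
  ext x
  simp only [Module.End.mul_apply, LinearMap.sum_apply, LinearMap.smul_apply, Lminus_apply]
  rw [Tplus_apply f (mulRepr (ℛ ℂ x) (antipodeRepr r))]
  simp only [mulRepr, antipodeRepr, Finset.sum_product_right, ← sum_apply_mul_apply t,
    Tplus_apply _ (ℛ ℂ x), Finset.sum_smul, Finset.sum_mul, Finset.smul_sum, smul_mul_assoc,
    smul_smul]
  exact Finset.sum_congr rfl fun i _ => Finset.sum_comm

lemma Tminus_mul_Lplus (hS : antipodeInv H = antipode ℂ) {f : Module.Dual ℂ H} {a : H}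
    (r : Repr ℂ a ι) (t : Repr ℂ f κ) :
    (Tminus f * Lplus a : Module.End ℂ H) = ∑ i ∈ r.index, ∑ j ∈ t.index,
      t.left j (antipode ℂ (r.left i)) • (Lplus (r.right i) * Tminus (t.right j)) := by
  ext x
  simp only [Module.End.mul_apply, LinearMap.sum_apply, LinearMap.smul_apply, Lplus_apply]
  rw [Tminus_apply f (mulRepr r (ℛ ℂ x))]
  simp only [mulRepr, Finset.sum_product, antipodeInv_mul, ← sum_apply_mul_apply t,
    Tminus_apply _ (ℛ ℂ x), Finset.sum_smul, Finset.mul_sum, Finset.smul_sum, mul_smul_comm,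
    smul_smul, ← hS]
  exact Finset.sum_congr rfl fun i _ => Finset.sum_comm

end SingleEdgeStar

/-! ### The convolution ring of the tensor product of `H` and `X` -/

section TensorConv

variable {C X A : Type*} [AddCommGroup C] [Module ℂ C] [Coalgebra ℂ C] [AddCommGroup X] [Module ℂ X]
  [Coalgebra ℂ X] [Ring A] [Algebra ℂ A]
variable {ι κ : Type*}

/-- A Sweedler representation of the coproduct of `a ⊗ f`. -/
def tmulRepr {a : C} {f : X} (r : Repr ℂ a ι) (t : Repr ℂ f κ) :
    Repr ℂ (a ⊗ₜ[ℂ] f) (ι × κ) where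
  index := r.index ×ˢ t.index
  left i := r.left i.1 ⊗ₜ t.left i.2
  right i := r.right i.1 ⊗ₜ t.right i.2
  eq := by
    simp [← r.eq, ← t.eq, TensorProduct.sum_tmul r.index, TensorProduct.tmul_sum,
      ← Finset.sum_product']

/-- A map on `C`, extended to `C ⊗ X` by the counit of `X`. -/
def extendLeft (α : C →ₗ[ℂ] A) : WithConv (C ⊗[ℂ] X →ₗ[ℂ] A) :=
  toConv (α ∘ₗ (TensorProduct.rid ℂ C).toLinearMap ∘ₗ (counit (R := ℂ) (A := X)).lTensor C)

/-- A map on `X`, extended to `C ⊗ X` by the counit of `C`. -/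
def extendRight (β : X →ₗ[ℂ] A) : WithConv (C ⊗[ℂ] X →ₗ[ℂ] A) :=
  toConv (β ∘ₗ (TensorProduct.lid ℂ X).toLinearMap ∘ₗ (counit (R := ℂ) (A := C)).rTensor X)

omit [Coalgebra ℂ C] in
lemma extendLeft_tmul (α : C →ₗ[ℂ] A) (a : C) (f : X) :
    extendLeft α (a ⊗ₜ[ℂ] f) = counit (R := ℂ) f • α a := by
  simp [extendLeft]

omit [Coalgebra ℂ X] in
lemma extendRight_tmul (β : X →ₗ[ℂ] A) (a : C) (f : X) :
    extendRight β (a ⊗ₜ[ℂ] f) = counit (R := ℂ) a • β f := by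
  simp [extendRight]

omit [Coalgebra ℂ C] [Coalgebra ℂ X] in
lemma tensorConv_ext {P Q : WithConv (C ⊗[ℂ] X →ₗ[ℂ] A)}
    (h : ∀ a f, P (a ⊗ₜ[ℂ] f) = Q (a ⊗ₜ[ℂ] f)) : P = Q := by
  apply WithConv.ext
  ext a f
  exact h a f

lemma convMul_tmul (P Q : WithConv (C ⊗[ℂ] X →ₗ[ℂ] A)) {a : C} {f : X} (r : Repr ℂ a ι)
    (t : Repr ℂ f κ) :
    (P * Q) (a ⊗ₜ[ℂ] f) = ∑ i ∈ r.index, ∑ j ∈ t.index,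
      P (r.left i ⊗ₜ t.left j) * Q (r.right i ⊗ₜ t.right j) := by
  rw [(tmulRepr r t).convMul_apply]
  simp [tmulRepr, Finset.sum_product]

lemma extendLeft_mul_apply (α : C →ₗ[ℂ] A) (P : WithConv (C ⊗[ℂ] X →ₗ[ℂ] A)) {a : C} {f : X}
    (r : Repr ℂ a ι) :
    (extendLeft α * P : WithConv (C ⊗[ℂ] X →ₗ[ℂ] A))
      (a ⊗ₜ[ℂ] f) = ∑ i ∈ r.index, α (r.left i) * P (r.right i ⊗ₜ f) := by
  rw [convMul_tmul _ _ r (ℛ ℂ f)]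
  refine Finset.sum_congr rfl fun i _ => ?_
  conv_rhs => rw [← sum_counit_smul (ℛ ℂ f)]
  simp [extendLeft_tmul, TensorProduct.tmul_sum, Finset.mul_sum]

lemma extendRight_mul_apply (β : X →ₗ[ℂ] A) (P : WithConv (C ⊗[ℂ] X →ₗ[ℂ] A)) {a : C} {f : X}
    (t : Repr ℂ f κ) :
    (extendRight β * P : WithConv (C ⊗[ℂ] X →ₗ[ℂ] A))
      (a ⊗ₜ[ℂ] f) = ∑ j ∈ t.index, β (t.left j) * P (a ⊗ₜ t.right j) := by
  rw [convMul_tmul _ _ (ℛ ℂ a) t, Finset.sum_comm]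
  refine Finset.sum_congr rfl fun j _ => ?_
  conv_rhs => rw [← sum_counit_smul (ℛ ℂ a)]
  simp [extendRight_tmul, TensorProduct.sum_tmul, Finset.mul_sum, ← TensorProduct.smul_tmul']

lemma extendLeft_mul_extendRight (α : C →ₗ[ℂ] A) (β : X →ₗ[ℂ] A) (a : C) (f : X) :
    (extendLeft α * extendRight β : WithConv (C ⊗[ℂ] X →ₗ[ℂ] A))
      (a ⊗ₜ[ℂ] f) = α a * β f := by
  rw [extendLeft_mul_apply _ _ (ℛ ℂ a)]
  conv_rhs => rw [← sum_counit_smul_left (ℛ ℂ a)]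
  simp [extendRight_tmul, Finset.sum_mul]

lemma extendRight_mul_extendLeft (α : C →ₗ[ℂ] A) (β : X →ₗ[ℂ] A) (a : C) (f : X) :
    (extendRight β * extendLeft α : WithConv (C ⊗[ℂ] X →ₗ[ℂ] A))
      (a ⊗ₜ[ℂ] f) = β f * α a := by
  rw [extendRight_mul_apply _ _ (ℛ ℂ f)]
  conv_rhs => rw [← sum_counit_smul_left (ℛ ℂ f)]
  simp [extendLeft_tmul, Finset.sum_mul]

lemma extendLeft_distribute (l : List (C →ₗ[ℂ] A)) :
    (extendLeft (distribute comul counit l) : WithConv (C ⊗[ℂ] X →ₗ[ℂ] A)) =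
      (l.map extendLeft).prod := by
  induction l with
  | nil =>
    refine tensorConv_ext fun a f => ?_
    simp [extendLeft_tmul, Algebra.smul_def, ← map_mul, mul_comm]
  | cons α l ih =>
    rw [List.map_cons, List.prod_cons, ← ih]
    refine tensorConv_ext fun a f => ?_
    rw [extendLeft_mul_apply _ _ (ℛ ℂ a), extendLeft_tmul, distribute_cons_apply α l (ℛ ℂ a)]
    simp [extendLeft_tmul, Finset.smul_sum]

lemma extendRight_distribute (l : List (X →ₗ[ℂ] A)) :
    (extendRight (distribute comul counit l) : WithConv (C ⊗[ℂ] X →ₗ[ℂ] A)) =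
      (l.map extendRight).prod := by
  induction l with
  | nil =>
    refine tensorConv_ext fun a f => ?_
    simp [extendRight_tmul, Algebra.smul_def, ← map_mul, mul_comm]
  | cons α l ih =>
    rw [List.map_cons, List.prod_cons, ← ih]
    refine tensorConv_ext fun a f => ?_
    rw [extendRight_mul_apply _ _ (ℛ ℂ f), extendRight_tmul, distribute_cons_apply α l (ℛ ℂ f)]
    simp [extendRight_tmul, Finset.smul_sum]

lemma comm_comul_tmul {a : C} {f : X}
    (ha : TensorProduct.comm ℂ C C (comul (R := ℂ) a) = comul (R := ℂ) a)
    (hf : TensorProduct.comm ℂ X X (comul (R := ℂ) f) = comul (R := ℂ) f) :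
    TensorProduct.comm ℂ _ _ (comul (R := ℂ) (a ⊗ₜ[ℂ] f)) = comul (R := ℂ) (a ⊗ₜ[ℂ] f) := by
  have h := (tmulRepr (ℛ ℂ a) (ℛ ℂ f)).eq
  let r : Repr ℂ a (C × C) := ⟨(ℛ ℂ a).index, (ℛ ℂ a).right, (ℛ ℂ a).left, by
    rw [← ha, ← (ℛ ℂ a).eq]; simp⟩
  let t : Repr ℂ f (X × X) := ⟨(ℛ ℂ f).index, (ℛ ℂ f).right, (ℛ ℂ f).left, by
    rw [← hf, ← (ℛ ℂ f).eq]; simp⟩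
  rw [← h, map_sum, h, ← (tmulRepr r t).eq]
  simp [tmulRepr, r, t]

end TensorConv

section Pairing

variable {H : Type*} [NormedRing H] [StarRing H] [HopfAlgebra ℂ H] [HopfCStarAlgebra H]
variable {A : Type*} [Ring A] [Algebra ℂ A]
variable {ι κ : Type*}

lemma sum_antipode_right_mul_left (hS : antipodeInv H = antipode ℂ) {a : H} (r : Repr ℂ a ι) :
    ∑ i ∈ r.index, antipode ℂ (r.right i) * r.left i = counit (R := ℂ) a • (1 : H) := by
  rw [← sum_antipodeInv_mul r, hS]

lemma sum_right_mul_antipode_left (hS : antipodeInv H = antipode ℂ) {a : H} (r : Repr ℂ a ι) :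
    ∑ i ∈ r.index, r.right i * antipode ℂ (r.left i) = counit (R := ℂ) a • (1 : H) := by
  have h := congrArg (antipodeInv H) (sum_mul_antipode_eq_smul r)
  rw [map_smul] at h
  have h1 : antipodeInv H (1 : H) = 1 := by rw [hS, antipode_one]
  simp only [map_sum, antipodeInv_mul, antipodeInv_antipode, h1] at h
  rw [← h, hS]

variable (A) in
/-- The pairing `a ⊗ f ↦ f(a)` of `H` and `X` as an invertible element of a convolution ring; its
inverse is `a ⊗ f ↦ f(S(a))`. -/
def pairing (hS : antipodeInv H = antipode ℂ) :
    (WithConv (H ⊗[ℂ] Module.Dual ℂ H →ₗ[ℂ] A))ˣ where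
  val := toConv (Algebra.linearMap ℂ A ∘ₗ TensorProduct.lift (Module.Dual.eval ℂ H))
  inv := toConv (Algebra.linearMap ℂ A ∘ₗ
    TensorProduct.lift (Module.Dual.eval ℂ H ∘ₗ antipode ℂ))
  val_inv := tensorConv_ext fun a f => by
    rw [convMul_tmul _ _ (ℛ ℂ a) (ℛ ℂ f)]
    have h := congrArg f (sum_antipode_right_mul_left hS (ℛ ℂ a))
    simp only [map_sum, map_smul, ← sum_apply_mul_apply (ℛ ℂ f)] at h
    simp [← map_mul, ← map_sum, h, counit_dual, mul_comm]
  inv_val := tensorConv_ext fun a f => by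
    rw [convMul_tmul _ _ (ℛ ℂ a) (ℛ ℂ f)]
    have h := congrArg f (sum_right_mul_antipode_left hS (ℛ ℂ a))
    simp only [map_sum, map_smul, ← sum_apply_mul_apply (ℛ ℂ f)] at h
    simp [← map_mul, ← map_sum, h, counit_dual, mul_comm]

variable (hS : antipodeInv H = antipode ℂ)

lemma pairing_tmul (a : H) (f : Module.Dual ℂ H) :
    (pairing A hS).val (a ⊗ₜ f) = algebraMap ℂ A (f a) := by
  simp [pairing]

lemma pairing_inv_tmul (a : H) (f : Module.Dual ℂ H) :
    ((pairing A hS)⁻¹).val (a ⊗ₜ f) =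
      algebraMap ℂ A (f (antipode ℂ a)) := by
  change Algebra.linearMap ℂ A (TensorProduct.lift (Module.Dual.eval ℂ H ∘ₗ antipode ℂ) (a ⊗ₜ f)) = _
  simp

/-- Conjugation with the pairing has no effect on the value at a cocommutative element. -/
lemma pairing_conj_apply (Q : WithConv (H ⊗[ℂ] Module.Dual ℂ H →ₗ[ℂ] A))
    {c : H ⊗[ℂ] Module.Dual ℂ H}
    (hc : TensorProduct.comm ℂ _ _ (comul (R := ℂ) c) = comul (R := ℂ) c) :
    (((pairing A hS)⁻¹).val * Q * (pairing A hS).val) c = Q c := by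
  rw [mul_assoc, convMul_apply_comm hc, mul_assoc, Units.mul_inv, mul_one]
  intro x y
  exact Algebra.commutes _ _

end Pairing

/-! ### Vertex and face operators of lists of half-edges -/

section OnEdge

variable {E H : Type*} [DecidableEq E] [NormedRing H] [HopfAlgebra ℂ H]

lemma onEdge_eq_map (e : E) (t : Module.End ℂ H) :
    (onEdge e t : Module.End ℂ (StateSpace E H)) =
      PiTensorProduct.map (Function.update (fun _ => LinearMap.id) e t) := rfl

lemma onEdge_tprod (e : E) (t : Module.End ℂ H) (x : E → H) :
    onEdge e t (PiTensorProduct.tprod ℂ x) =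
      PiTensorProduct.tprod ℂ (Function.update x e (t (x e))) := by
  rw [onEdge_eq_map, PiTensorProduct.map_tprod]
  congr 1
  ext e'
  by_cases h : e' = e
  · subst h; simp
  · simp [h]

lemma onEdge_mul (e : E) (t t' : Module.End ℂ H) :
    (onEdge e (t * t') : Module.End ℂ (StateSpace E H)) = onEdge e t * onEdge e t' := by
  ext x
  simp [onEdge_tprod]

lemma commute_onEdge {e e' : E} (h : e ≠ e') (t t' : Module.End ℂ H) :
    Commute (onEdge e t : Module.End ℂ (StateSpace E H)) (onEdge e' t') := by
  ext x
  simp [onEdge_tprod, Function.update_of_ne h, Function.update_of_ne h.symm,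
    Function.update_comm h]

lemma commute_onEdge_same (e : E) {t t' : Module.End ℂ H} (h : Commute t t') :
    Commute (onEdge e t : Module.End ℂ (StateSpace E H)) (onEdge e t') := by
  rw [commute_iff_eq, ← onEdge_mul, h.eq, onEdge_mul]

/-- The opposite end of the edge of a half-edge. -/
def flipEnd (d : E × Bool) : E × Bool := (d.1, !d.2)

omit [DecidableEq E] in
lemma eq_or_eq_flipEnd {d d' : E × Bool} (h : d'.1 = d.1) : d' = d ∨ d' = flipEnd d := by
  obtain ⟨e, b⟩ := d
  obtain ⟨e', b'⟩ := d'
  obtain rfl : e' = e := h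
  cases b <;> cases b' <;> simp [flipEnd]

omit [DecidableEq E] in
lemma flipEnd_ne (d : E × Bool) : flipEnd d ≠ d := by
  obtain ⟨e, b⟩ := d
  cases b <;> simp [flipEnd]

lemma vertexAction_apply (d : E × Bool) (a : H) :
    (vertexAction d a : Module.End ℂ (StateSpace E H)) =
      onEdge d.1 (if d.2 then Lplus a else Lminus a) := by
  obtain ⟨e, b⟩ := d
  cases b <;> rfl

lemma vertexAction_mul (d : E × Bool) (a b : H) :
    (vertexAction d (a * b) : Module.End ℂ (StateSpace E H)) =
      vertexAction d a * vertexAction d b := by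
  simp only [vertexAction_apply, ← onEdge_mul]
  split_ifs <;> simp [Lplus_mul, Lminus_mul]

lemma commute_vertexAction {d d' : E × Bool} (h : d ≠ d') (a b : H) :
    Commute (vertexAction d a : Module.End ℂ (StateSpace E H)) (vertexAction d' b) := by
  simp only [vertexAction_apply]
  by_cases he : d.1 = d'.1
  · obtain ⟨e, c⟩ := d
    obtain ⟨e', c'⟩ := d'
    obtain rfl : e = e' := he
    apply commute_onEdge_same
    cases c <;> cases c'
    · exact absurd rfl h
    · exact (commute_Lplus_Lminus _ _).symm
    · exact commute_Lplus_Lminus _ _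
    · exact absurd rfl h
  · exact commute_onEdge he _ _

end OnEdge

section OnEdgeStar

variable {E H : Type*} [DecidableEq E] [NormedRing H] [StarRing H] [HopfAlgebra ℂ H]
  [HopfCStarAlgebra H]

lemma faceAction_apply (d : E × Bool) (f : Module.Dual ℂ H) :
    (faceAction d f : Module.End ℂ (StateSpace E H)) =
      onEdge d.1 (if d.2 then Tminus f else Tplus f) := by
  obtain ⟨e, b⟩ := d
  cases b <;> rfl

lemma faceAction_mul (d : E × Bool) (f g : Module.Dual ℂ H) :
    (faceAction d (dualMul f g) : Module.End ℂ (StateSpace E H)) =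
      faceAction d f * faceAction d g := by
  simp only [faceAction_apply, ← onEdge_mul]
  split_ifs <;> simp [Tplus_mul, Tminus_mul]

lemma commute_faceAction {d d' : E × Bool} (h : d ≠ d') (f g : Module.Dual ℂ H) :
    Commute (faceAction d f : Module.End ℂ (StateSpace E H)) (faceAction d' g) := by
  simp only [faceAction_apply]
  by_cases he : d.1 = d'.1
  · obtain ⟨e, c⟩ := d
    obtain ⟨e', c'⟩ := d'
    obtain rfl : e = e' := he
    apply commute_onEdge_same
    cases c <;> cases c'
    · exact absurd rfl h
    · exact commute_Tplus_Tminus _ _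
    · exact (commute_Tplus_Tminus _ _).symm
    · exact absurd rfl h
  · exact commute_onEdge he _ _

variable (hS : antipodeInv H = antipode ℂ)

/-- The convolution ring in which the vertex and face actions are compared. -/
abbrev ActionRing (E H : Type*) [NormedRing H] [StarRing H] [HopfAlgebra ℂ H]
    [HopfCStarAlgebra H] : Type _ :=
  WithConv (H ⊗[ℂ] Module.Dual ℂ H →ₗ[ℂ] Module.End ℂ (StateSpace E H))

/-- The exchange relation of the two actions at the same half-edge. -/
lemma face_mul_vertex_same (d : E × Bool) :
    (extendRight (faceAction d) * extendLeft (vertexAction d) : ActionRing E H) =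
      ((pairing _ hS)⁻¹).val * extendLeft (vertexAction d) * extendRight (faceAction d) := by
  refine tensorConv_ext fun a f => ?_
  rw [extendRight_mul_extendLeft, mul_assoc, convMul_tmul _ _ (ℛ ℂ a) (ℛ ℂ f)]
  simp only [extendLeft_mul_extendRight, pairing_inv_tmul, ← Algebra.smul_def,
    vertexAction_apply, faceAction_apply, ← onEdge_mul]
  obtain ⟨e, b⟩ := d
  cases b
  · simp [Tplus_mul_Lminus (ℛ ℂ a) (ℛ ℂ f)]
  · simp [Tminus_mul_Lplus hS (ℛ ℂ a) (ℛ ℂ f)]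

/-- The exchange relation of the two actions at opposite ends of an edge. -/
lemma face_mul_vertex_flipEnd (d : E × Bool) :
    (extendRight (faceAction d) * extendLeft (vertexAction (flipEnd d)) : ActionRing E H) =
      extendLeft (vertexAction (flipEnd d)) * extendRight (faceAction d) *
        (pairing _ hS).val := by
  refine tensorConv_ext fun a f => ?_
  rw [extendRight_mul_extendLeft, convMul_tmul _ _ (ℛ ℂ a) (ℛ ℂ f)]
  simp only [extendLeft_mul_extendRight, pairing_tmul, ← Algebra.commutes, ← Algebra.smul_def,
    vertexAction_apply, faceAction_apply, flipEnd, ← onEdge_mul]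
  obtain ⟨e, b⟩ := d
  cases b
  · simp [Tplus_mul_Lplus (ℛ ℂ a) (ℛ ℂ f)]
  · simp [Tminus_mul_Lminus (ℛ ℂ a) (ℛ ℂ f)]

lemma face_mul_vertex (e d : E × Bool) :
    (extendRight (faceAction e) * extendLeft (vertexAction d) : ActionRing E H) =
      (if d = e then ((pairing _ hS)⁻¹).val else 1) * extendLeft (vertexAction d) *
        extendRight (faceAction e) * (if d = flipEnd e then (pairing _ hS).val else 1) := by
  by_cases he : d.1 = e.1
  · rcases eq_or_eq_flipEnd he with rfl | rfl
    · rw [if_pos rfl, if_neg (flipEnd_ne d).symm, mul_one]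
      exact face_mul_vertex_same hS d
    · rw [if_pos rfl, if_neg (flipEnd_ne e), one_mul]
      exact face_mul_vertex_flipEnd hS e
  · rw [if_neg fun h : d = e => he (by rw [h]),
      if_neg fun h : d = flipEnd e => he (by rw [h]; rfl), one_mul, mul_one]
    refine tensorConv_ext fun a f => ?_
    rw [extendRight_mul_extendLeft, extendLeft_mul_extendRight, vertexAction_apply,
      faceAction_apply]
    exact (commute_onEdge (Ne.symm he) _ _).eq

variable [Finite E] {φ : Module.Dual ℂ H} {h : H}

/-- The vertex operator of `h` and the face operator of `φ` commute if the lists of half-edges start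
at a common corner of vertex and face, or if there is none. -/
lemma commute_vertexOpOn_faceOpOn (hφ : IsHaarFunctional φ) (hh : IsHaarIntegral h)
    (next : Equiv.Perm (E × Bool)) (d e : E × Bool)
    (hde : d = e ∨ d ∉ cycleList (turnPerm next) e ∧ e ∉ cycleList next d) :
    Commute (vertexOpOn (cycleList next d) h : Module.End ℂ (StateSpace E H))
      (faceOpOn (cycleList (turnPerm next) e) φ) := by
  obtain ⟨m, hm, hm₁, hm₂⟩ := exists_cycleList_eq next d
  obtain ⟨l, hl, hl₁, hl₂⟩ := exists_cycleList_eq (turnPerm next) e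
  have hmn := nodup_cycleList next d
  have hln := nodup_cycleList (turnPerm next) e
  rw [hm] at hde hmn ⊢
  rw [hl] at hde hln ⊢
  have hd : d ∉ l := by
    rcases hde with rfl | hde
    · exact (List.nodup_cons.1 hln).1
    · exact fun hmem => hde.1 (by simp [hmem])
  have he : e ∉ m := by
    rcases hde with rfl | hde
    · exact (List.nodup_cons.1 hmn).1
    · exact fun hmem => hde.2 (by simp [hmem])
  have hS := hφ.antipodeInv_eq hh
  obtain ⟨c, hc, hcomm⟩ := prod_mul_prod (M := ActionRing E H) (u := pairing _ hS)
    (L := fun d => extendLeft (vertexAction d)) (T := fun e => extendRight (faceAction e))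
    (flip := flipEnd) next.injective (face_mul_vertex hS) d m hm₁ hm₂ e l hl₁ hl₂ hd he
  have hL : ∀ l : List (E × Bool),
      (l.map fun d => (extendLeft (vertexAction d) : ActionRing E H)).prod =
        extendLeft (vertexOpOn l) := fun l => by
    rw [vertexOpOn, extendLeft_distribute, List.map_map]; rfl
  have hT : ∀ l : List (E × Bool),
      (l.map fun d => (extendRight (faceAction d) : ActionRing E H)).prod =
        extendRight (faceOpOn l) := fun l => by
    change _ = extendRight (distribute comul counit _)
    rw [extendRight_distribute, List.map_map]; rfl
  rw [hL, hT] at hcomm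
  have hconj := congrArg (fun P : ActionRing E H => P (h ⊗ₜ φ)) hcomm
  rw [extendRight_mul_extendLeft] at hconj
  have hcc := comm_comul_tmul (hφ.comm_comul_integral hh) (hφ.comm_comul hh)
  rcases hc with rfl | rfl
  · rw [inv_one, Units.val_one, one_mul, mul_one, extendLeft_mul_extendRight] at hconj
    exact hconj.symm
  · rw [pairing_conj_apply hS _ hcc, extendLeft_mul_extendRight] at hconj
    exact hconj.symm

end OnEdgeStar

/-! ### The inner product of the state space -/

section InnerProduct

open scoped ComplexOrder

variable {E H : Type*} [NormedRing H] [StarRing H] [HopfAlgebra ℂ H] [HopfCStarAlgebra H]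
variable {φ : Module.Dual ℂ H} {h : H}

section Sesquilinear

variable [Finite E] (φ)

lemma innerProd_add_left (x y z : StateSpace E H) :
    innerProd φ (x + y) z = innerProd φ x z + innerProd φ y z := by
  simp [innerProd, add_mul]

lemma innerProd_add_right (x y z : StateSpace E H) :
    innerProd φ x (y + z) = innerProd φ x y + innerProd φ x z := by
  simp [innerProd, mul_add]

lemma innerProd_smul_left (c : ℂ) (x y : StateSpace E H) :
    innerProd φ (c • x) y = conj c * innerProd φ x y := by
  simp [innerProd, starMap_smul]

lemma innerProd_smul_right (c : ℂ) (x y : StateSpace E H) :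
    innerProd φ x (c • y) = c * innerProd φ x y := by
  simp [innerProd]

/-- The inner product as a sesquilinear form. -/
def innerForm : StateSpace E H →ₗ⋆[ℂ] StateSpace E H →ₗ[ℂ] ℂ :=
  LinearMap.mk₂'ₛₗ (starRingEnd ℂ) (RingHom.id ℂ) (innerProd φ) (innerProd_add_left φ)
    (innerProd_smul_left φ) (innerProd_add_right φ) (innerProd_smul_right φ)

@[simp] lemma innerForm_apply (x y : StateSpace E H) : innerForm φ x y = innerProd φ x y := rfl

end Sesquilinear

omit [StarRing H] [HopfCStarAlgebra H] in
/-- Sesquilinear forms agree if they agree on product vectors. -/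
lemma innerForm_ext {B B' : StateSpace E H →ₗ⋆[ℂ] StateSpace E H →ₗ[ℂ] ℂ}
    (h : ∀ x y : E → H, B (PiTensorProduct.tprod ℂ x) (PiTensorProduct.tprod ℂ y) =
      B' (PiTensorProduct.tprod ℂ x) (PiTensorProduct.tprod ℂ y)) : B = B' := by
  ext x : 1
  induction x using PiTensorProduct.induction_on with
  | smul_tprod c x =>
    rw [LinearMap.map_smulₛₗ, LinearMap.map_smulₛₗ]
    congr 1
    ext y
    exact h x y
  | add x z hx hz => rw [map_add, map_add, hx, hz]

lemma innerProd_conj_symm [Finite E] (hφ : IsHaarFunctional φ) (hh : IsHaarIntegral h)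
    (x y : StateSpace E H) : conj (innerProd φ x y) = innerProd φ y x := by
  cases nonempty_fintype E
  let B : StateSpace E H →ₗ⋆[ℂ] StateSpace E H →ₗ[ℂ] ℂ :=
    LinearMap.mk₂'ₛₗ (starRingEnd ℂ) (RingHom.id ℂ) (fun x y => conj (innerProd φ y x))
      (by simp [innerProd_add_right]) (by simp [innerProd_smul_right])
      (by simp [innerProd_add_left]) (by simp [innerProd_smul_left])
  have h : innerForm φ = B := innerForm_ext fun x y => by
    simp [B, innerProd_tprod, map_prod, ← hφ.apply_star hh]
  exact (LinearMap.congr_fun₂ h y x).symm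

lemma isInnerProduct [Finite E] (hφ : IsHaarFunctional φ) (hh : IsHaarIntegral h) :
    IsInnerProduct E φ := by
  refine ⟨innerProd_conj_symm hφ hh, fun x hx => ?_⟩
  cases nonempty_fintype E
  classical
  -- Products of vectors from an orthonormal basis of `H` form an orthonormal basis.
  obtain ⟨b, hb⟩ := exists_orthonormal_basis φ fun a ha => hφ.pos hh ha
  let B := Basis.piTensorProduct fun _ : E => b
  have hB : ∀ p q, innerForm φ (B p) (B q) = if p = q then 1 else 0 := by
    intro p q
    simp only [B, Basis.piTensorProduct_apply, innerForm_apply, innerProd_tprod, hb]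
    by_cases hpq : p = q
    · simp [hpq]
    · obtain ⟨e, he⟩ := Function.ne_iff.1 hpq
      rw [if_neg hpq, Finset.prod_eq_zero (Finset.mem_univ e) (if_neg he)]
  have hsum : innerProd φ x x = ∑ p, conj (B.repr x p) * B.repr x p := by
    rw [← innerForm_apply]
    conv_lhs => rw [← B.sum_repr x]
    simp only [map_sum, LinearMap.map_smulₛₗ, LinearMap.sum_apply, LinearMap.smul_apply, map_smul,
      hB]
    simp [mul_comm]
  have hne : ∃ p, B.repr x p ≠ 0 := by
    by_contra! h0
    exact hx (B.ext_elem fun p => by simp [h0 p])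
  obtain ⟨p, hp⟩ := hne
  rw [hsum, Complex.re_sum]
  refine Finset.sum_pos' (fun q _ => ?_) ⟨p, Finset.mem_univ p, ?_⟩
  · rw [← Complex.normSq_eq_conj_mul_self, Complex.ofReal_re]
    exact Complex.normSq_nonneg _
  · rw [← Complex.normSq_eq_conj_mul_self, Complex.ofReal_re]
    exact Complex.normSq_pos.2 hp

/-- `T'` is adjoint to `T` for the inner product of the state space. -/
def IsAdjoint [Finite E] (φ : Module.Dual ℂ H) (T T' : Module.End ℂ (StateSpace E H)) : Prop :=
  ∀ x y, innerProd φ (T x) y = innerProd φ x (T' y)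

lemma isAdjoint_onEdge [Finite E] [DecidableEq E] (φ : Module.Dual ℂ H) (e : E)
    {t t' : Module.End ℂ H} (ht : ∀ x y, φ (star (t x) * y) = φ (star x * t' y)) :
    IsAdjoint (E := E) φ (onEdge e t) (onEdge e t') := by
  cases nonempty_fintype E
  have h : (innerForm φ).comp (onEdge e t) = (innerForm φ).compl₂ (onEdge e t') :=
    innerForm_ext fun x y => by
      simp only [LinearMap.comp_apply, LinearMap.compl₂_apply, onEdge_tprod, innerForm_apply,
        innerProd_tprod]
      refine Finset.prod_congr rfl fun e' _ => ?_
      by_cases he : e' = e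
      · subst he; simp [ht]
      · simp [he]
  exact fun x y => LinearMap.congr_fun₂ h x y

lemma pairwise_map_of_nodup {D C : Type*} {l : List D} (hl : l.Nodup)
    {α : D → C} {R : C → C → Prop} (h : ∀ d d', d ≠ d' → R (α d) (α d')) :
    (l.map α).Pairwise R :=
  List.pairwise_map.2 (hl.imp fun hne => h _ _ hne)

section Operators

variable [Finite E] [DecidableEq E] (hφ : IsHaarFunctional φ) (hh : IsHaarIntegral h)
include hφ hh

lemma isAdjoint_vertexAction (d : E × Bool) (a : H) :
    IsAdjoint (E := E) φ (vertexAction d a) (vertexAction d (star a)) := by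
  simp only [vertexAction_apply]
  refine isAdjoint_onEdge φ _ fun x y => ?_
  split_ifs
  · exact apply_star_Lplus φ a x y
  · exact hφ.apply_star_Lminus hh a x y

omit hh in
lemma isAdjoint_faceAction (d : E × Bool) (f : Module.Dual ℂ H) :
    IsAdjoint (E := E) φ (faceAction d f) (faceAction d (dualStar f)) := by
  simp only [faceAction_apply]
  refine isAdjoint_onEdge φ _ fun x y => ?_
  split_ifs
  · exact hφ.apply_star_Tminus f x y
  · exact hφ.apply_star_Tplus f x y

omit [DecidableEq E] hh hφ in
lemma isAdjoint_algebraMap (z : ℂ) :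
    IsAdjoint (E := E) φ (algebraMap ℂ _ z) (algebraMap ℂ _ (conj z)) := by
  intro x y
  simp [Module.algebraMap_end_apply, innerProd_smul_left, innerProd_smul_right]

lemma isHermitian_vertexOpOn {l : List (E × Bool)} (hl : l.Nodup) :
    IsHermitian (E := E) φ (vertexOpOn l h) := by
  have := distribute_adjoint (IsAdjoint (E := E) φ) (fun x y => by simp [innerProd])
    (fun hT hT' x y => by
      simp [innerProd_add_left, innerProd_add_right, hT x y, hT' x y])
    (fun hT hT' x y => by simp [hT _ _, hT' _ _]) isAdjoint_algebraMap (star : H → H)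
    (fun c => by rw [← (starRepr (ℛ ℂ c)).eq]; rfl) counit_star
    (l.map vertexAction) (fun α hα c => by
      obtain ⟨d, -, rfl⟩ := List.mem_map.1 hα
      exact isAdjoint_vertexAction hφ hh d c)
    (pairwise_map_of_nodup hl fun d d' hne a b => commute_vertexAction hne a b) h
  rwa [hh.star_eq] at this

lemma isHermitian_faceOpOn {l : List (E × Bool)} (hl : l.Nodup) :
    IsHermitian (E := E) φ (faceOpOn l φ) := by
  have := distribute_adjoint (IsAdjoint (E := E) φ) (fun x y => by simp [innerProd])
    (fun hT hT' x y => by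
      simp [innerProd_add_left, innerProd_add_right, hT x y, hT' x y])
    (fun hT hT' x y => by simp [hT _ _, hT' _ _]) isAdjoint_algebraMap dualStar
    comul_dualStar counit_dualStar
    (l.map faceAction) (fun α hα c => by
      obtain ⟨d, -, rfl⟩ := List.mem_map.1 hα
      exact isAdjoint_faceAction hφ d c)
    (pairwise_map_of_nodup hl fun d d' hne a b => commute_faceAction hne a b) φ
  rwa [hφ.dualStar_eq hh] at this

omit [StarRing H] [HopfCStarAlgebra H] [Finite E] hφ in
lemma isIdempotentElem_vertexOpOn {l : List (E × Bool)} (hl : l.Nodup) :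
    IsIdempotentElem (vertexOpOn l h : Module.End ℂ (StateSpace E H)) := by
  have := distribute_mul (A := Module.End ℂ (StateSpace E H)) (fun a b : H => a * b)
    (fun a b => by
      rw [← (mulRepr (ℛ ℂ a) (ℛ ℂ b)).eq, mulRepr, Finset.sum_product])
    (fun a b => by simp)
    (l.map vertexAction) (fun α hα a b => by
      obtain ⟨d, -, rfl⟩ := List.mem_map.1 hα
      exact vertexAction_mul d a b)
    (pairwise_map_of_nodup hl fun d d' hne a b => commute_vertexAction hne a b) h h
  rw [(hh.1 h).1, hh.2, one_smul] at this
  exact this.symm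

omit [Finite E] hh in
lemma isIdempotentElem_faceOpOn {l : List (E × Bool)} (hl : l.Nodup) :
    IsIdempotentElem (faceOpOn l φ : Module.End ℂ (StateSpace E H)) := by
  have hφφ : dualMul φ φ = φ := by
    ext x
    have := congrArg φ (hφ.sum_smul_left (ℛ ℂ x))
    rw [dualMul_apply φ φ (ℛ ℂ x)]
    simpa [mul_comm, hφ.2] using this
  have := distribute_mul (A := Module.End ℂ (StateSpace E H)) dualMul comul_dualMul
    (fun f g => by
      simp only [counit_dual]
      rw [dualMul]
      simp [LinearMap.convMul_apply, Algebra.TensorProduct.one_def])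
    (l.map faceAction) (fun α hα a b => by
      obtain ⟨d, -, rfl⟩ := List.mem_map.1 hα
      exact faceAction_mul d a b)
    (pairwise_map_of_nodup hl fun d d' hne a b => commute_faceAction hne a b) φ φ
  rw [hφφ] at this
  exact this.symm

end Operators

end InnerProduct

/-! ### The operators of an embedded graph -/

section Support

variable {E H : Type*} [NormedRing H] [StarRing H] [HopfAlgebra ℂ H]

omit [StarRing H] in
lemma IsSupportedOn.mul {K : Set E} {T T' : Module.End ℂ (StateSpace E H)}
    (hT : IsSupportedOn T K) (hT' : IsSupportedOn T' K) : IsSupportedOn (T * T') K := by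
  have h := Submodule.mul_mem_mul hT hT'
  rw [Submodule.span_mul_span] at h
  refine Submodule.span_mono ?_ h
  rintro _ ⟨_, ⟨t, ht, rfl⟩, _, ⟨t', ht', rfl⟩, rfl⟩
  exact ⟨t * t', fun e he => by rw [Pi.mul_apply, ht e he, ht' e he]; rfl,
    (PiTensorProduct.map_mul t t').symm⟩

variable (H) in
omit [StarRing H] in
/-- The algebra of operators which act on the tensor factors in `K` only. -/
def supportedOn (K : Set E) : Subalgebra ℂ (Module.End ℂ (StateSpace E H)) :=
  (Submodule.span ℂ {P | ∃ t : E → Module.End ℂ H, (∀ e, e ∉ K → t e = LinearMap.id) ∧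
    P = PiTensorProduct.map t}).toSubalgebra
    (Submodule.subset_span ⟨fun _ => LinearMap.id, fun _ _ => rfl, PiTensorProduct.map_id.symm⟩)
    fun _ _ hT hT' => IsSupportedOn.mul hT hT'

variable [DecidableEq E]

omit [StarRing H] in
lemma onEdge_mem_supportedOn {K : Set E} {e : E} (he : e ∈ K) (t : Module.End ℂ H) :
    onEdge e t ∈ supportedOn H K :=
  Submodule.subset_span ⟨Function.update (fun _ => LinearMap.id) e t,
    fun e' he' => Function.update_of_ne (fun h : e' = e => he' (h ▸ he)) t
      (fun _ => LinearMap.id), onEdge_eq_map e t⟩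

omit [StarRing H] in
lemma vertexOpOn_mem_supportedOn {K : Set E} {l : List (E × Bool)} (hl : ∀ d ∈ l, d.1 ∈ K)
    (a : H) : vertexOpOn l a ∈ supportedOn H K :=
  distribute_mem _ _ (fun α hα c => by
    obtain ⟨d, hd, rfl⟩ := List.mem_map.1 hα
    exact onEdge_mem_supportedOn (hl d hd) _) a

lemma faceOpOn_mem_supportedOn [HopfCStarAlgebra H] {K : Set E} {l : List (E × Bool)}
    (hl : ∀ d ∈ l, d.1 ∈ K) (f : Module.Dual ℂ H) : faceOpOn l f ∈ supportedOn H K :=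
  distribute_mem (C := Module.Dual ℂ H) _ _ (fun α hα c => by
    obtain ⟨d, hd, rfl⟩ := List.mem_map.1 hα
    exact onEdge_mem_supportedOn (hl d hd) _) f

end Support

section ListOperators

variable {E H : Type*} [DecidableEq E] [NormedRing H] [StarRing H] [HopfAlgebra ℂ H]
  [HopfCStarAlgebra H] {φ : Module.Dual ℂ H} {h : H}

omit [StarRing H] [HopfCStarAlgebra H] in
lemma commute_vertexOpOn {l l' : List (E × Bool)} (hl : ∀ d ∈ l, d ∉ l') (a b : H) :
    Commute (vertexOpOn l a : Module.End ℂ (StateSpace E H)) (vertexOpOn l' b) := by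
  refine commute_distribute (l'.map vertexAction) (fun β hβ y => ?_) b
  obtain ⟨d', hd', rfl⟩ := List.mem_map.1 hβ
  refine (commute_distribute (a := vertexAction d' y) (l.map vertexAction)
    (fun α hα x => ?_) a).symm
  obtain ⟨d, hd, rfl⟩ := List.mem_map.1 hα
  exact commute_vertexAction (fun hdd : d' = d => hl d hd (hdd ▸ hd')) y x

lemma commute_faceOpOn {l l' : List (E × Bool)} (hl : ∀ d ∈ l, d ∉ l') (f g : Module.Dual ℂ H) :
    Commute (faceOpOn l f : Module.End ℂ (StateSpace E H)) (faceOpOn l' g) := by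
  refine commute_distribute (C := Module.Dual ℂ H) (l'.map faceAction) (fun β hβ y => ?_) g
  obtain ⟨d', hd', rfl⟩ := List.mem_map.1 hβ
  refine (commute_distribute (C := Module.Dual ℂ H) (a := faceAction d' y) (l.map faceAction)
    (fun α hα x => ?_) f).symm
  obtain ⟨d, hd, rfl⟩ := List.mem_map.1 hα
  exact commute_faceAction (fun hdd : d' = d => hl d hd (hdd ▸ hd')) y x

lemma vertexOpOn_cycleList_apply [Finite E] (hφ : IsHaarFunctional φ) (hh : IsHaarIntegral h)
    (f : Equiv.Perm (E × Bool)) (d : E × Bool) :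
    (vertexOpOn (cycleList f (f d)) h : Module.End ℂ (StateSpace E H)) =
      vertexOpOn (cycleList f d) h := by
  obtain ⟨l, hl, -⟩ := exists_cycleList_eq f d
  have hn := nodup_cycleList f d
  rw [cycleList_apply f d hl]
  rw [hl] at hn ⊢
  rw [vertexOpOn, vertexOpOn, List.map_append, List.map_cons]
  refine distribute_rotate (hφ.comm_comul_integral hh) fun β hβ x y => ?_
  obtain ⟨d', hd', rfl⟩ := List.mem_map.1 hβ
  exact commute_vertexAction (fun hdd : d = d' => (List.nodup_cons.1 hn).1 (hdd ▸ hd')) _ _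

lemma faceOpOn_cycleList_apply [Finite E] (hφ : IsHaarFunctional φ) (hh : IsHaarIntegral h)
    (f : Equiv.Perm (E × Bool)) (d : E × Bool) :
    (faceOpOn (cycleList f (f d)) φ : Module.End ℂ (StateSpace E H)) =
      faceOpOn (cycleList f d) φ := by
  obtain ⟨l, hl, -⟩ := exists_cycleList_eq f d
  have hn := nodup_cycleList f d
  rw [cycleList_apply f d hl]
  rw [hl] at hn ⊢
  rw [faceOpOn, faceOpOn, List.map_append, List.map_cons]
  refine distribute_rotate (C := Module.Dual ℂ H) (hφ.comm_comul hh) fun β hβ x y => ?_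
  obtain ⟨d', hd', rfl⟩ := List.mem_map.1 hβ
  exact commute_faceAction (fun hdd : d = d' => (List.nodup_cons.1 hn).1 (hdd ▸ hd')) _ _

omit [StarRing H] [HopfCStarAlgebra H] in
/-- The vector `⨂ h` is fixed by all vertex operators of `h`. -/
lemma vertexOpOn_tprod_integral (hh : IsHaarIntegral h)
    (l : List (E × Bool)) (a : H) :
    vertexOpOn l a (PiTensorProduct.tprod ℂ fun _ : E => h) =
      counit (R := ℂ) a • PiTensorProduct.tprod ℂ fun _ : E => h := by
  have hd : ∀ (d : E × Bool) (a : H), vertexAction d a (PiTensorProduct.tprod ℂ fun _ : E => h) =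
      counit (R := ℂ) a • PiTensorProduct.tprod ℂ fun _ : E => h := by
    intro d a
    rw [vertexAction_apply, onEdge_tprod]
    have : (if d.2 then Lplus a else Lminus a) h = counit (R := ℂ) a • h := by
      split_ifs
      · exact (hh.1 a).1
      · exact ((hh.1 _).2).trans (by simp)
    rw [this, MultilinearMap.map_update_smul, Function.update_eq_self]
  induction l generalizing a with
  | nil => simp [vertexOpOn, Module.algebraMap_end_apply]
  | cons d l ih =>
    have hc : vertexOpOn (d :: l) a = ∑ i ∈ (ℛ ℂ a).index,
        vertexAction (H := H) d ((ℛ ℂ a).left i) * vertexOpOn l ((ℛ ℂ a).right i) :=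
      distribute_cons_apply _ _ (ℛ ℂ a)
    rw [hc, LinearMap.sum_apply]
    simp only [Module.End.mul_apply, ih, map_smul, hd, smul_smul, ← Finset.sum_smul]
    congr 1
    have := congrArg (counit (R := ℂ)) (sum_counit_smul (ℛ ℂ a))
    simpa [mul_comm] using this

/-- The vector `⨂ 1` is fixed by all face operators of `φ`. -/
lemma faceOpOn_tprod_one (l : List (E × Bool)) (f : Module.Dual ℂ H) :
    faceOpOn l f (PiTensorProduct.tprod ℂ fun _ : E => (1 : H)) =
      f 1 • PiTensorProduct.tprod ℂ fun _ : E => (1 : H) := by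
  have hd : ∀ (d : E × Bool) (f : Module.Dual ℂ H),
      faceAction d f (PiTensorProduct.tprod ℂ fun _ : E => (1 : H)) =
      f 1 • PiTensorProduct.tprod ℂ fun _ : E => (1 : H) := by
    intro d f
    rw [faceAction_apply, onEdge_tprod]
    have : (if d.2 then Tminus f else Tplus f) (1 : H) = f 1 • 1 := by
      split_ifs <;>
        simp [Tminus, Tplus, Algebra.TensorProduct.one_def, antipodeInv]
    rw [this, MultilinearMap.map_update_smul, Function.update_eq_self]
  induction l generalizing f with
  | nil => simp [faceOpOn, distribute, counitX, Module.algebraMap_end_apply]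
  | cons d l ih =>
    have hc : faceOpOn (d :: l) f = ∑ i ∈ (ℛ ℂ f).index,
        faceAction (H := H) d ((ℛ ℂ f).left i) * faceOpOn l ((ℛ ℂ f).right i) :=
      distribute_cons_apply (C := Module.Dual ℂ H) _ _ (ℛ ℂ f)
    rw [hc, LinearMap.sum_apply]
    simp only [Module.End.mul_apply, ih, map_smul, hd, smul_smul, ← Finset.sum_smul]
    congr 1
    have := sum_apply_mul_apply (ℛ ℂ f) 1 1
    simpa [mul_comm] using this

end ListOperators

namespace EmbeddedGraph

variable {V E F H : Type*} [Finite E] [NormedRing H] [StarRing H]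
  [HopfAlgebra ℂ H] [HopfCStarAlgebra H] {φ : Module.Dual ℂ H} {h : H} (Γ : EmbeddedGraph V E F)

omit [Finite E] in
lemma nodup_vertexList (s : V) : (Γ.vertexList s).Nodup := by
  rw [vertexList]
  split_ifs
  · exact nodup_cycleList _ _
  · exact List.nodup_nil

omit [Finite E] in
lemma nodup_faceList (p : F) : (Γ.faceList p).Nodup := by
  rw [faceList]
  split_ifs
  · exact nodup_cycleList _ _
  · exact List.nodup_nil

lemma vertex_eq_of_mem_cycleList {d d' : E × Bool} (hd : d' ∈ cycleList Γ.next d) :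
    Γ.vertex d' = Γ.vertex d :=
  eq_of_sameCycle _ Γ.vertex_next (sameCycle_of_mem_cycleList _ _ hd)

lemma face_eq_of_mem_cycleList {d d' : E × Bool} (hd : d' ∈ cycleList Γ.turn d) :
    Γ.face d' = Γ.face d :=
  eq_of_sameCycle _ Γ.face_turn (sameCycle_of_mem_cycleList _ _ hd)

lemma vertex_eq_of_mem_vertexList {s : V} {d : E × Bool} (hd : d ∈ Γ.vertexList s) :
    Γ.vertex d = some s := by
  rw [vertexList] at hd
  split_ifs at hd with hs
  · rw [Γ.vertex_eq_of_mem_cycleList hd, hs.choose_spec]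
  · simp at hd

lemma face_eq_of_mem_faceList {p : F} {d : E × Bool} (hd : d ∈ Γ.faceList p) :
    Γ.face d = some p := by
  rw [faceList] at hd
  split_ifs at hd with hp
  · rw [Γ.face_eq_of_mem_cycleList hd, hp.choose_spec]
  · simp at hd

variable [DecidableEq E]

lemma siteVertexOp_eq_A (hφ : IsHaarFunctional φ) (hh : IsHaarIntegral h) {d : E × Bool} {s : V}
    (hd : Γ.vertex d = some s) : Γ.siteVertexOp h d = Γ.A h s := by
  have hs : ∃ d, Γ.vertex d = some s := ⟨d, hd⟩
  rw [A, vertexList, dif_pos hs]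
  exact eq_of_sameCycle (g := Γ.siteVertexOp h) _ (vertexOpOn_cycleList_apply hφ hh _)
    (Γ.sameCycle_of_vertex _ _ s hs.choose_spec hd)

lemma siteFaceOp_eq_B (hφ : IsHaarFunctional φ) (hh : IsHaarIntegral h) {d : E × Bool} {p : F}
    (hd : Γ.face d = some p) : Γ.siteFaceOp φ d = Γ.B φ p := by
  have hp : ∃ d, Γ.face d = some p := ⟨d, hd⟩
  rw [B, faceList, dif_pos hp]
  exact eq_of_sameCycle (g := Γ.siteFaceOp φ) _ (faceOpOn_cycleList_apply hφ hh _)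
    (Γ.sameCycle_of_face _ _ p hp.choose_spec hd)

omit [StarRing H] [HopfCStarAlgebra H] in
lemma commute_A_A (s s' : V) : Commute (Γ.A h s) (Γ.A h s') := by
  by_cases hs : s = s'
  · rw [hs]
  · refine commute_vertexOpOn (fun d hd hd' => hs ?_) h h
    exact Option.some_injective _
      ((Γ.vertex_eq_of_mem_vertexList hd).symm.trans (Γ.vertex_eq_of_mem_vertexList hd'))

lemma commute_B_B (p p' : F) : Commute (Γ.B φ p) (Γ.B φ p') := by
  by_cases hp : p = p'
  · rw [hp]
  · refine commute_faceOpOn (fun d hd hd' => hp ?_) φ φ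
    exact Option.some_injective _
      ((Γ.face_eq_of_mem_faceList hd).symm.trans (Γ.face_eq_of_mem_faceList hd'))

lemma commute_A_B (hφ : IsHaarFunctional φ) (hh : IsHaarIntegral h) (s : V) (p : F) :
    Commute (Γ.A h s) (Γ.B φ p) := by
  by_cases hs : ∃ d, Γ.vertex d = some s
  swap
  · rw [A, vertexList, dif_neg hs]
    exact Algebra.commute_algebraMap_left (counit (R := ℂ) h) _
  by_cases hp : ∃ d, Γ.face d = some p
  swap
  · rw [B, faceList, dif_neg hp]
    exact Algebra.commute_algebraMap_right (φ 1) _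
  by_cases hx : ∃ x, Γ.vertex x = some s ∧ Γ.face x = some p
  · -- Both operators may be computed at a common site.
    obtain ⟨x, hxs, hxp⟩ := hx
    rw [← Γ.siteVertexOp_eq_A hφ hh hxs, ← Γ.siteFaceOp_eq_B hφ hh hxp]
    exact commute_vertexOpOn_faceOpOn hφ hh Γ.next x x (Or.inl rfl)
  · obtain ⟨d, hd⟩ := hs
    obtain ⟨e, he⟩ := hp
    rw [← Γ.siteVertexOp_eq_A hφ hh hd, ← Γ.siteFaceOp_eq_B hφ hh he]
    refine commute_vertexOpOn_faceOpOn hφ hh Γ.next d e (Or.inr ⟨fun hmem => hx ⟨d, hd, ?_⟩,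
      fun hmem => hx ⟨e, ?_, he⟩⟩)
    · rw [Γ.face_eq_of_mem_cycleList hmem, he]
    · rw [Γ.vertex_eq_of_mem_cycleList hmem, hd]

lemma isSupportedOn_localTerm (i : V ⊕ F) :
    IsSupportedOn (Γ.localTerm h φ i) (Γ.localSupport i) := by
  cases i with
  | inl s =>
    exact (supportedOn H (Γ.edgesAtVertex s)).neg_mem (vertexOpOn_mem_supportedOn
      (fun d hd => show d.1 ∈ Γ.edgesAtVertex s from ⟨d.2, Γ.vertex_eq_of_mem_vertexList hd⟩) h)
  | inr p =>
    exact (supportedOn H (Γ.edgesAtFace p)).neg_mem (faceOpOn_mem_supportedOn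
      (fun d hd => show d.1 ∈ Γ.edgesAtFace p from ⟨d.2, Γ.face_eq_of_mem_faceList hd⟩) φ)

end EmbeddedGraph

/-! ### Ground states -/

section FrustrationFree

variable {E H : Type*} [Finite E] [NormedRing H] [StarRing H] [HopfAlgebra ℂ H]
  [HopfCStarAlgebra H] {φ : Module.Dual ℂ H}

variable (φ) in
/-- The square `(x, x)` of the norm of a vector. -/
def normSq (x : StateSpace E H) : ℝ := (innerProd φ x x).re

lemma IsInnerProduct.normSq_pos (hip : IsInnerProduct E φ) {x : StateSpace E H} (hx : x ≠ 0) :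
    0 < normSq φ x := hip.2 x hx

lemma IsInnerProduct.normSq_nonneg (hip : IsInnerProduct E φ) (x : StateSpace E H) :
    0 ≤ normSq φ x := by
  by_cases hx : x = 0
  · simp [hx, normSq, innerProd]
  · exact (hip.normSq_pos hx).le

/-- For a Hermitian projector `P` the energy of `-P` exceeds its minimum by `‖x - P x‖²`. -/
lemma IsHermitian.innerProd_apply {P : Module.End ℂ (StateSpace E H)} (hP : IsIdempotentElem P)
    (hP' : IsHermitian φ P) (x : StateSpace E H) :
    innerProd φ x (P x) = innerProd φ x x - innerProd φ (x - P x) (x - P x) := by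
  have hPP : P (P x) = P x := congrArg (fun T : Module.End ℂ (StateSpace E H) => T x) hP
  have h1 : innerProd φ (P x) (x - P x) = 0 := by
    rw [hP', map_sub, hPP, sub_self]
    simp [innerProd]
  have h2 : ∀ y z w : StateSpace E H, innerProd φ (y - z) w = innerProd φ y w - innerProd φ z w :=
    fun y z w => by simp [innerProd, sub_mul]
  have h3 : innerProd φ x (x - P x) = innerProd φ x x - innerProd φ x (P x) := by
    simp [innerProd, mul_sub]
  rw [h2, h1, h3]
  ring

variable {ι : Type*} [Fintype ι] {P : ι → Module.End ℂ (StateSpace E H)}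

/-- The energy `μ` of an eigenvector `x` exceeds the lower bound `-|ι|` by
`∑ ‖x - P i x‖² / ‖x‖²`. -/
lemma eigenvalue_re_mul_normSq (hP : ∀ i, IsIdempotentElem (P i))
    (hP' : ∀ i, IsHermitian φ (P i)) (hip : IsInnerProduct E φ) {μ : ℂ} {x : StateSpace E H}
    (hx : (-∑ i, P i) x = μ • x) :
    μ.re * normSq φ x = -Fintype.card ι * normSq φ x + ∑ i, normSq φ (x - P i x) := by
  have him : (innerProd φ x x).im = 0 := Complex.conj_eq_iff_im.1 (hip.1 x x)
  have h1 : innerProd φ x ((-∑ i, P i) x) = -∑ i, innerProd φ x (P i x) := by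
    simp [innerProd, Finset.mul_sum]
  rw [hx, innerProd_smul_right] at h1
  have h2 := congrArg Complex.re h1
  simp only [(hP' _).innerProd_apply (hP _), Complex.mul_re, him, mul_zero, sub_zero,
    Complex.neg_re, Complex.re_sum, Complex.sub_re, Finset.sum_sub_distrib, Finset.sum_const,
    Finset.card_univ, nsmul_eq_mul, Complex.natCast_re] at h2
  simp only [normSq]
  linarith

/-- If Hermitian projectors have a common fixed vector, then the ground states of minus their sum
are exactly their common fixed vectors. -/
lemma isGroundState_neg_sum_iff (hP : ∀ i, IsIdempotentElem (P i))
    (hP' : ∀ i, IsHermitian φ (P i)) (hip : IsInnerProduct E φ) {ψ₀ : StateSpace E H}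
    (hψ₀ : ψ₀ ≠ 0) (hfix : ∀ i, P i ψ₀ = ψ₀) {ψ : StateSpace E H} :
    IsGroundState (-∑ i, P i) ψ ↔ ψ ≠ 0 ∧ ∀ i, P i ψ = ψ := by
  have hT : ∀ x : StateSpace E H, (∀ i, P i x = x) →
      (-∑ i, P i) x = ((-Fintype.card ι : ℝ) : ℂ) • x := fun x hx => by
    simp [hx, Nat.cast_smul_eq_nsmul]
  constructor
  · rintro ⟨hψ, E₀, hE₀, hmin⟩
    refine ⟨hψ, fun i => ?_⟩
    have h1 : E₀ ≤ -Fintype.card ι := by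
      simpa using hmin _ (Module.End.hasEigenvalue_of_hasEigenvector
        ⟨Module.End.mem_eigenspace_iff.2 (hT ψ₀ hfix), hψ₀⟩)
    have h2 := eigenvalue_re_mul_normSq hP hP' hip hE₀
    rw [Complex.ofReal_re] at h2
    have h3 := mul_le_mul_of_nonneg_right h1 (hip.normSq_nonneg ψ)
    have h4 : normSq φ (ψ - P i ψ) ≤ ∑ i, normSq φ (ψ - P i ψ) :=
      Finset.single_le_sum (f := fun i => normSq φ (ψ - P i ψ))
        (fun i _ => hip.normSq_nonneg _) (Finset.mem_univ i)
    by_contra hne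
    have h5 := hip.normSq_pos (sub_ne_zero.2 (Ne.symm hne))
    linarith
  · rintro ⟨hψ, hfixψ⟩
    refine ⟨hψ, -Fintype.card ι, hT ψ hfixψ, fun μ hμ => ?_⟩
    obtain ⟨x, hx⟩ := hμ.exists_hasEigenvector
    have h2 := eigenvalue_re_mul_normSq hP hP' hip hx.apply_eq_smul
    have h3 : 0 ≤ ∑ i, normSq φ (x - P i x) := Finset.sum_nonneg fun i _ => hip.normSq_nonneg _
    exact le_of_mul_le_mul_right (by linarith) (hip.normSq_pos hx.2)

/-- Commuting Hermitian projectors with a common fixed vector make up a frustration-free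
Hamiltonian; for one term the ground states are given by `isGroundState_neg_sum_iff` with a single
index. -/
lemma isFrustrationFree_neg (hP : ∀ i, IsIdempotentElem (P i))
    (hP' : ∀ i, IsHermitian φ (P i)) (hcomm : ∀ i j, Commute (P i) (P j))
    (hip : IsInnerProduct E φ) {ψ₀ : StateSpace E H}
    (hψ₀ : ψ₀ ≠ 0) (hfix : ∀ i, P i ψ₀ = ψ₀) :
    IsFrustrationFree (-∑ i, P i) fun i => -P i where
  eq_sum := by rw [Finset.sum_neg_distrib]
  commute i j := (hcomm i j).neg_left.neg_right
  exists_groundState := ⟨ψ₀, (isGroundState_neg_sum_iff hP hP' hip hψ₀ hfix).2 ⟨hψ₀, hfix⟩⟩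
  groundState_term ψ hψ i := by
    rw [isGroundState_neg_sum_iff hP hP' hip hψ₀ hfix] at hψ
    have := isGroundState_neg_sum_iff (ι := Unit) (P := fun _ => P i) (ψ := ψ) (fun _ => hP i)
      (fun _ => hP' i) hip hψ₀ fun _ => hfix i
    rw [Fintype.sum_unique] at this
    exact this.2 ⟨hψ.1, fun _ => hψ.2 i⟩

end FrustrationFree

namespace EmbeddedGraph

variable {V E F H : Type*} [Finite E] [DecidableEq E] [NormedRing H] [StarRing H]
  [HopfAlgebra ℂ H] [HopfCStarAlgebra H] {φ : Module.Dual ℂ H} {h : H} (Γ : EmbeddedGraph V E F)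

/-- A common fixed vector of all projectors: apply the product of all `B(p)` to `⨂ h`. Since every
`B(p)` is Hermitian and fixes `⨂ 1`, the inner product with `⨂ 1` remains `φ(h) ^ |E| ≠ 0`. -/
lemma exists_fixed_vector [Finite F] (hφ : IsHaarFunctional φ) (hh : IsHaarIntegral h) :
    ∃ ψ : StateSpace E H, ψ ≠ 0 ∧ (∀ s, Γ.A h s ψ = ψ) ∧ ∀ p, Γ.B φ p ψ = ψ := by
  cases nonempty_fintype E
  cases nonempty_fintype F
  have key : ∀ S : Finset F, ∃ ψ : StateSpace E H, (∀ s, Γ.A h s ψ = ψ) ∧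
      (∀ p ∈ S, Γ.B φ p ψ = ψ) ∧
      innerProd φ (PiTensorProduct.tprod ℂ fun _ : E => (1 : H)) ψ = ∏ _e : E, φ h := by
    intro S
    classical
    induction S using Finset.induction_on with
    | empty =>
      refine ⟨PiTensorProduct.tprod ℂ fun _ => h, fun s => ?_, by simp, ?_⟩
      · rw [A, vertexOpOn_tprod_integral hh, hh.2, one_smul]
      · simp [innerProd_tprod]
    | insert p S hp ih =>
      obtain ⟨ψ, hA, hB, hΩ⟩ := ih
      have comm : ∀ {T T' : Module.End ℂ (StateSpace E H)}, Commute T T' → T ψ = ψ →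
          T (T' ψ) = T' ψ := fun {T T'} hT hψ => by
        rw [← Module.End.mul_apply, hT.eq, Module.End.mul_apply, hψ]
      refine ⟨Γ.B φ p ψ, fun s => comm (Γ.commute_A_B hφ hh s p) (hA s), fun p' hp' => ?_, ?_⟩
      · rcases Finset.mem_insert.1 hp' with rfl | hp'
        · exact congrArg (fun T : Module.End ℂ (StateSpace E H) => T ψ)
            (isIdempotentElem_faceOpOn hφ (Γ.nodup_faceList p'))
        · exact comm (Γ.commute_B_B p' p) (hB p' hp')
      · rw [B, ← isHermitian_faceOpOn hφ hh (Γ.nodup_faceList p), faceOpOn_tprod_one, hφ.2, one_smul,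
          hΩ]
  obtain ⟨ψ, hA, hB, hΩ⟩ := key Finset.univ
  refine ⟨ψ, ?_, hA, fun p => hB p (Finset.mem_univ p)⟩
  rintro rfl
  refine Finset.prod_ne_zero_iff.2 (fun _ _ => hφ.apply_integral_ne_zero hh) (hΩ.symm.trans ?_)
  simp [innerProd]

end EmbeddedGraph

end

end QuantumDouble

open QuantumDouble in
theorem mainTheorem2
    {H : Type*} [NormedRing H] [StarRing H] [HopfAlgebra ℂ H] [HopfCStarAlgebra H]
    (h : H) (hh : IsHaarIntegral h)
    (φ : Module.Dual ℂ H) (hφ : IsHaarFunctional φ)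
    {V E F : Type*} [Fintype V] [Fintype E] [DecidableEq E] [Fintype F]
    (Γ : EmbeddedGraph V E F) :
    -- the state space with the inner product induced by `φ` is a Hilbert space
    IsInnerProduct E φ ∧
    -- `A(s) = A_h(s, p)` and `B(p) = B_φ(s, p)` for every site `(s, p)`
    (∀ d s, Γ.vertex d = some s → Γ.siteVertexOp h d = Γ.A h s) ∧
    (∀ d p, Γ.face d = some p → Γ.siteFaceOp φ d = Γ.B φ p) ∧
    -- Hermitian projectors
    (∀ s, IsIdempotentElem (Γ.A h s) ∧ IsHermitian φ (Γ.A h s)) ∧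
    (∀ p, IsIdempotentElem (Γ.B φ p) ∧ IsHermitian φ (Γ.B φ p)) ∧
    -- mutually commuting
    (∀ s s', Commute (Γ.A h s) (Γ.A h s')) ∧
    (∀ p p', Commute (Γ.B φ p) (Γ.B φ p')) ∧
    (∀ s p, Commute (Γ.A h s) (Γ.B φ p)) ∧
    -- the Hamiltonian is local and frustration-free
    (∀ i, IsSupportedOn (Γ.localTerm h φ i) (Γ.localSupport i)) ∧
    IsFrustrationFree (Γ.hamiltonian h φ) (Γ.localTerm h φ) := by
  have hip : IsInnerProduct E φ := isInnerProduct hφ hh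
  have hA : ∀ s, IsIdempotentElem (Γ.A h s) ∧ IsHermitian φ (Γ.A h s) := fun s =>
    ⟨isIdempotentElem_vertexOpOn hh (Γ.nodup_vertexList s),
      isHermitian_vertexOpOn hφ hh (Γ.nodup_vertexList s)⟩
  have hB : ∀ p, IsIdempotentElem (Γ.B φ p) ∧ IsHermitian φ (Γ.B φ p) := fun p =>
    ⟨isIdempotentElem_faceOpOn hφ (Γ.nodup_faceList p),
      isHermitian_faceOpOn hφ hh (Γ.nodup_faceList p)⟩
  refine ⟨hip, fun d s => Γ.siteVertexOp_eq_A hφ hh, fun d p => Γ.siteFaceOp_eq_B hφ hh, hA, hB,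
    Γ.commute_A_A, Γ.commute_B_B, Γ.commute_A_B hφ hh, Γ.isSupportedOn_localTerm, ?_⟩
  obtain ⟨ψ, hψ, hAψ, hBψ⟩ := Γ.exists_fixed_vector hφ hh
  have hff := isFrustrationFree_neg (P := Sum.elim (Γ.A h) (Γ.B φ))
    (Sum.rec (fun s => (hA s).1) fun p => (hB p).1)
    (Sum.rec (fun s => (hA s).2) fun p => (hB p).2)
    (Sum.rec (fun s => Sum.rec (Γ.commute_A_A s) (Γ.commute_A_B hφ hh s))
      fun p => Sum.rec (fun s => (Γ.commute_A_B hφ hh s p).symm) (Γ.commute_B_B p))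
    hip hψ (Sum.rec hAψ hBψ)
  convert hff using 1
  · rw [EmbeddedGraph.hamiltonian, Fintype.sum_sum_type, neg_add, ← sub_eq_add_neg]
    rfl
  · ext1 i
    cases i <;> rfl
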